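/- **Setting.** Texts are nonempty finite lists of words; queries use a vocabulary $A$, documents a vocabulary $B$, both finite. The trainable parameters $w$ are the embedding vectors in $\mathbb{R}^p$ of all words of both vocabularies, with the Euclidean norm on all entries together. A query $q=q_1\dots q_t$ is encoded as $f_q=\tanh\big(\frac1t\sum_{i=1}^t \mathrm{Emb}_A(q_i)\big)\in\mathbb{R}^p$ ($\tanh$ taken coordinatewise), and a document $d$ likewise as $f_d$ with $\mathrm{Emb}_B$. For $\varepsilon>0$ the relevance score is the smooth cosine similarity $$r_\varepsilon(q,d)=\frac{f_q^{T}f_d}{(\|f_q\|+\varepsilon)(\|f_d\|+\varepsilon)}\in(-1,1).$$ Let $l(r,y)$, $y\in\{1,\dots,K\}$, be a loss with $0\le l(r,y)\le M$ for $r\in(-1,1)$ that is $\kappa$-smooth in $r$ on $(-1,1)$ (differentiable with $\kappa$-Lipschitz derivative, for every $y$). An example is the Smooth Ordinal Search Loss $$\mathrm{SOSL}(r,y)=(\theta_y-r)^2\,\mathbb{1}[r>\theta_y]+(r-\theta_{y-1})^2\,\mathbb{1}[r<\theta_{y-1}],\qquad -1=\theta_0<\dots<\theta_K=1,$$ which satisfies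 this with $\kappa=2$, $M=4$. The loss of $w$ on an example $z=(q,d,y)$ is $l(w;z)=l(r_\varepsilon(q,d),y)$. For a probability distribution $E$ of examples and a sample $S=(z_1,\dots,z_n)$ put $L_E(w)=\mathbb{E}_{z\sim E}\,l(w;z)$ and $L_S(w)=\frac1n\sum_{i=1}^n l(w;z_i)$. SGD starts at a fixed $w_0$ and, for $t=1,\dots,T$, sets $w_t=w_{t-1}-\frac ct\nabla_w l(w_{t-1};z_{i_t})$ with independent indices $i_t$ uniform on $\{1,\dots,n\}$, where $c>0$. **Theorem (generalization error bound).** There are $\alpha_0\ge0$ and $\gamma_0>0$, depending only on $\varepsilon,\kappa,M$ and $c$, such that $w\mapsto l(w;z)$ is $\alpha_0$-Lipschitz and $\gamma_0$-smooth for every example $z$. Moreover, let $\alpha\ge0$ and $\gamma>0$ be any constants such that $w\mapsto l(w;z)$ is $\alpha$-Lipschitz and $\gamma$-smooth for every example $z$. Then for every $T\ge1$ there is $\beta:\mathbb{N}\to\mathbb{R}$ with $$0\le\beta(n)\le C\,\frac{T^{\,1-1/(\gamma c+1)}}{n}\qquad(n\ge1),$$ where $C$ depends only on $\alpha,\gamma,c,M$,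 such that for every $w_0$, every distribution $E$, every $n\ge1$ and every $\delta\in(0,1)$, with probability at least $1-\delta$ over the draw of $S\sim E^n$, $$\mathbb{E}_{i_1,\dots,i_T}\big[L_E(w_T)-L_S(w_T)\big]\le 2\beta(n)+(4n\beta(n)+M)\sqrt{\frac{\ln(1/\delta)}{2n}}.$$ -/

import Mathlib

open MeasureTheory
open scoped BigOperators NNReal

noncomputable section

namespace SmoothSearch

/-- A tokenized text: a nonempty list of words from a vocabulary of size `v`. -/
abbrev Text (v : ℕ) : Type := {q : List (Fin v) // q ≠ []}

/-- A labelled example: a query in language `A` (vocabulary size `a`), a document in language `B`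
(vocabulary size `b`), and a relevance label, one of `K` ordered classes. The class called `y` in
`{1, …, K}` is represented by the element `y - 1` of `Fin K`. -/
structure Sample (a b K : ℕ) where
  query : Text a
  doc : Text b
  label : Fin K

/-- The set of examples is countable; it carries the discrete σ-algebra. -/
instance (a b K : ℕ) : MeasurableSpace (Sample a b K) := ⊤

/-- The trainable parameters: one embedding vector in `ℝ^p` for each word of each of the two
vocabularies, with the Euclidean norm on all the entries together. -/
abbrev Params (a b p : ℕ) : Type := EuclideanSpace ℝ ((Fin a ⊕ Fin b) × Fin p)

/-- The encoder: average pooling of the word embeddings, followed by a coordinatewise `tanh`. -/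
def encode {v p : ℕ} (W : Fin v → Fin p → ℝ) (q : Text v) : EuclideanSpace ℝ (Fin p) :=
  WithLp.toLp 2 fun j => Real.tanh ((∑ i : Fin q.1.length, W (q.1.get i) j) / q.1.length)

/-- The query model `f_q`. -/
def encodeQuery {a b p : ℕ} (w : Params a b p) (q : Text a) : EuclideanSpace ℝ (Fin p) :=
  encode (fun t j => w (Sum.inl t, j)) q

/-- The document model `f_d`. -/
def encodeDoc {a b p : ℕ} (w : Params a b p) (d : Text b) : EuclideanSpace ℝ (Fin p) :=
  encode (fun t j => w (Sum.inr t, j)) d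

/-- Smooth cosine similarity of two vectors. -/
def smoothCos {p : ℕ} (ε : ℝ) (x z : EuclideanSpace ℝ (Fin p)) : ℝ :=
  inner ℝ x z / ((‖x‖ + ε) * (‖z‖ + ε))

/-- The relevance score `r_ε(q, d)` of the model with parameters `w`. -/
def relevance {a b p : ℕ} (ε : ℝ) (w : Params a b p) (q : Text a) (d : Text b) : ℝ :=
  smoothCos ε (encodeQuery w q) (encodeDoc w d)

/-- The loss on the example `z`, as a function of the model parameters. -/
def sampleLoss {a b p K : ℕ} (l : ℝ → Fin K → ℝ) (ε : ℝ) (z : Sample a b K)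
    (w : Params a b p) : ℝ :=
  l (relevance ε w z.query z.doc) z.label

/-- `f` is `γ`-smooth on `s` (used for open sets `s`): it is differentiable there and its gradient
is `γ`-Lipschitz. -/
def SmoothOnWith {F : Type*} [NormedAddCommGroup F] [InnerProductSpace ℝ F] [CompleteSpace F]
    (γ : ℝ) (f : F → ℝ) (s : Set F) : Prop :=
  (∀ u ∈ s, DifferentiableAt ℝ f u) ∧
    ∀ u ∈ s, ∀ v ∈ s, ‖gradient f u - gradient f v‖ ≤ γ * ‖u - v‖

/-- A loss function of the relevance score and the label that is `κ`-smooth in the score and takes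
values in `[0, M]`. Relevance scores always lie in the open interval `(-1, 1)`, so nothing is
required of `l` at other scores. -/
def IsSmoothBoundedLoss {K : ℕ} (κ M : ℝ) (l : ℝ → Fin K → ℝ) : Prop :=
  ∀ y, SmoothOnWith κ (fun r => l r y) (Set.Ioo (-1) 1) ∧
    ∀ r ∈ Set.Ioo (-1 : ℝ) 1, 0 ≤ l r y ∧ l r y ≤ M

/-- Smooth Ordinal Search Loss with thresholds `θ₀, …, θ_K`. -/
def sosl {K : ℕ} (θ : Fin (K + 1) → ℝ) (r : ℝ) (y : Fin K) : ℝ :=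
  (if θ y.succ < r then (θ y.succ - r) ^ 2 else 0) +
    (if r < θ y.castSucc then (r - θ y.castSucc) ^ 2 else 0)

/-- The expected error `L_E(f)` of the model with parameters `w`. -/
def expectedError {a b p K : ℕ} (l : ℝ → Fin K → ℝ) (ε : ℝ) (E : Measure (Sample a b K))
    (w : Params a b p) : ℝ :=
  ∫ z, sampleLoss l ε z w ∂E

/-- The training error `L_S(f)` of the model with parameters `w`. -/
def trainingError {a b p K n : ℕ} (l : ℝ → Fin K → ℝ) (ε : ℝ) (S : Fin n → Sample a b K)
    (w : Params a b p) : ℝ :=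
  (∑ i, sampleLoss l ε (S i) w) / n

/-- `T` gradient steps from `w₀`, where step `t ∈ {1, …, T}` has step size `c / t` and uses the
gradient of the `t`-th objective in the list `obj`. -/
def gradientSteps {F : Type*} [NormedAddCommGroup F] [InnerProductSpace ℝ F] [CompleteSpace F]
    (c : ℝ) (w₀ : F) : (T : ℕ) → (Fin T → F → ℝ) → F
  | 0, _ => w₀
  | T + 1, obj =>
    let w := gradientSteps c w₀ T fun t => obj t.castSucc
    w - (c / ((T + 1 : ℕ) : ℝ)) • gradient (obj (Fin.last T)) w

/-- The output of `T` steps of SGD on the training sample `S`, when step `t` uses the training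
example with index `ι t`. -/
def sgd {a b p K n : ℕ} (l : ℝ → Fin K → ℝ) (ε c : ℝ) (w₀ : Params a b p)
    (S : Fin n → Sample a b K) {T : ℕ} (ι : Fin T → Fin n) : Params a b p :=
  gradientSteps c w₀ T fun t => sampleLoss l ε (S (ι t))

/-- The generalization error `L_E(f) - L_S(f)` of the output `f` of `T` steps of SGD on `S`, in
expectation over the indices of the examples used, which are independent and uniform. -/
def sgdGeneralizationError {a b p K n : ℕ} (l : ℝ → Fin K → ℝ) (ε c : ℝ) (w₀ : Params a b p)
    (T : ℕ) (E : Measure (Sample a b K)) (S : Fin n → Sample a b K) : ℝ :=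
  Finset.expect Finset.univ fun ι : Fin T → Fin n =>
    expectedError l ε E (sgd l ε c w₀ S ι) - trainingError l ε S (sgd l ε c w₀ S ι)

end SmoothSearch

end

/-!
The theorem has three independent parts.

*The loss is Lipschitz and smooth in the parameters, with constants free of all dimensions.* The
class `C11On B L` of maps whose derivative is bounded by `B` and `L`-Lipschitz is closed under
composition and under inner products of maps into the unit ball. The encoder is an average of
coordinate projections followed by a coordinatewise `tanh`, whose derivative is a diagonal operator;
diagonal operators have the supremum of their entries as norm, so nothing depends on `p`
(`c11On_encode`). The relevance is the inner product of two smoothed normalizations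
`x / (‖x‖ + ε)`. These are in the class although the norm is not differentiable at `0`: the singular
part of the derivative is `v ↦ ⟪x, v⟫ x / ‖x‖`, which is Lipschitz in `x`
(`c11On_smoothNormalize`).

*SGD is uniformly stable* (`uniform_stability_sgd`). Two runs on samples that differ in one place
stay together until that place is first used. If that happens within the first
`t₀ ≈ T ^ (γ c / (γ c + 1))` steps, which has probability at most `t₀ / n`, the losses differ by at
most `M`. The discrepancies that enter after step `t₀` are amplified only moderately, because the
step sizes `c / t` decay, and they contribute at most `(2 α² / γ) (T / t₀) ^ (γ c) / n` in the
mean. The two contributions are of the same order for this `t₀`. The argument is run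
pointwise in the choice of indices: the difference of the losses is at most a fixed weighted count
of the uses of the exceptional index, and each use has probability `1 / n`.

*Uniform stability implies generalization* (`generalization_of_uniform_stability`). Exchanging a
training example with a fresh one shows that the generalization error has mean at most `β`; it
changes by at most `2 β + M / n` when one example is replaced, and McDiarmid's inequality
(`measureReal_boundedDifferences_le`, by induction from Hoeffding's lemma) does the rest.
-/

noncomputable section

namespace SmoothSearch

/-! ### Maps with bounded and Lipschitz derivative -/

section Calculus

variable {E F G : Type*} [NormedAddCommGroup E] [NormedSpace ℝ E] [NormedAddCommGroup F]
  [NormedSpace ℝ F] [NormedAddCommGroup G] [NormedSpace ℝ G]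

/-- `f` is differentiable at the points of `s`, and there its derivative is bounded by `B` and
`L`-Lipschitz. -/
def C11On (B L : ℝ) (f : E → F) (s : Set E) : Prop :=
  ∃ f' : E → E →L[ℝ] F, (∀ x ∈ s, HasFDerivAt f (f' x) x) ∧ (∀ x ∈ s, ‖f' x‖ ≤ B) ∧
    ∀ x ∈ s, ∀ y ∈ s, ‖f' x - f' y‖ ≤ L * ‖x - y‖

lemma C11On.norm_sub_le {B L : ℝ} {f : E → F} (hf : C11On B L f Set.univ) (x y : E) :
    ‖f x - f y‖ ≤ B * ‖x - y‖ := by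
  obtain ⟨f', h1, h2, -⟩ := hf
  exact convex_univ.norm_image_sub_le_of_norm_hasFDerivWithin_le
    (fun z hz => (h1 z hz).hasFDerivWithinAt) h2 (Set.mem_univ y) (Set.mem_univ x)

lemma C11On.comp {B L B' L' : ℝ} {h : F → G} {f : E → F} {s : Set F} (hh : C11On B' L' h s)
    (hf : C11On B L f Set.univ) (hs : ∀ x, f x ∈ s) (hL' : 0 ≤ L') :
    C11On (B' * B) (L' * B ^ 2 + B' * L) (fun x => h (f x)) Set.univ := by
  have hlip := hf.norm_sub_le
  obtain ⟨f', f1, f2, f3⟩ := hf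
  obtain ⟨h', h1, h2, h3⟩ := hh
  refine ⟨fun x => (h' (f x)).comp (f' x), fun x hx => (h1 _ (hs x)).comp x (f1 x hx),
    fun x hx => ?_, fun x hx y hy => ?_⟩
  · exact (ContinuousLinearMap.opNorm_comp_le _ _).trans
      (mul_le_mul (h2 _ (hs x)) (f2 x hx) (norm_nonneg _) ((norm_nonneg _).trans (h2 _ (hs x))))
  · have hB : 0 ≤ B := (norm_nonneg _).trans (f2 x hx)
    have hB' : 0 ≤ B' := (norm_nonneg _).trans (h2 _ (hs x))
    have e : (h' (f x)).comp (f' x) - (h' (f y)).comp (f' y) =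
        (h' (f x) - h' (f y)).comp (f' x) + (h' (f y)).comp (f' x - f' y) := by
      ext v; simp
    have a1 : ‖(h' (f x) - h' (f y)).comp (f' x)‖ ≤ (L' * (B * ‖x - y‖)) * B :=
      (ContinuousLinearMap.opNorm_comp_le _ _).trans (mul_le_mul
        ((h3 _ (hs x) _ (hs y)).trans (mul_le_mul_of_nonneg_left (hlip x y) hL'))
        (f2 x hx) (norm_nonneg _) (by positivity))
    have a2 : ‖(h' (f y)).comp (f' x - f' y)‖ ≤ B' * (L * ‖x - y‖) :=
      (ContinuousLinearMap.opNorm_comp_le _ _).trans (mul_le_mul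
        (h2 _ (hs y)) (f3 x hx y hy) (norm_nonneg _) hB')
    rw [e]
    calc _ ≤ _ := norm_add_le _ _
      _ ≤ (L' * (B * ‖x - y‖)) * B + B' * (L * ‖x - y‖) := add_le_add a1 a2
      _ = _ := by ring

lemma c11On_continuousLinearMap {B : ℝ} (A : E →L[ℝ] F) (hA : ‖A‖ ≤ B) :
    C11On B 0 A Set.univ :=
  ⟨fun _ => A, fun _ _ => A.hasFDerivAt, fun _ _ => hA, fun _ _ _ _ => by simp⟩

lemma C11On.inner {H : Type*} [NormedAddCommGroup H] [InnerProductSpace ℝ H] {B L B' L' : ℝ}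
    {f g : E → H} (hf : C11On B L f Set.univ) (hg : C11On B' L' g Set.univ)
    (f_le : ∀ x, ‖f x‖ ≤ 1) (g_le : ∀ x, ‖g x‖ ≤ 1) :
    C11On (B + B') (L + L' + 2 * B * B') (fun x => inner ℝ (f x) (g x)) Set.univ := by
  have hflip := hf.norm_sub_le
  have hglip := hg.norm_sub_le
  obtain ⟨f', f1, f2, f3⟩ := hf
  obtain ⟨g', g1, g2, g3⟩ := hg
  refine ⟨fun x => (fderivInnerCLM ℝ (f x, g x)).comp ((f' x).prod (g' x)),
    fun x hx => (f1 x hx).inner ℝ (g1 x hx), fun x hx => ?_, fun x hx y hy => ?_⟩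
  · have hB : 0 ≤ B := (norm_nonneg _).trans (f2 x hx)
    have hB' : 0 ≤ B' := (norm_nonneg _).trans (g2 x hx)
    refine ContinuousLinearMap.opNorm_le_bound _ (by positivity) fun v => ?_
    have h1 : ‖f' x v‖ ≤ B * ‖v‖ := (f' x).le_of_opNorm_le (f2 x hx) v
    have h2 : ‖g' x v‖ ≤ B' * ‖v‖ := (g' x).le_of_opNorm_le (g2 x hx) v
    have h3 : ‖(Inner.inner ℝ (f x) (g' x v) : ℝ)‖ ≤ 1 * (B' * ‖v‖) :=
      (norm_inner_le_norm _ _).trans (mul_le_mul (f_le x) h2 (norm_nonneg _) zero_le_one)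
    have h4 : ‖(Inner.inner ℝ (f' x v) (g x) : ℝ)‖ ≤ (B * ‖v‖) * 1 :=
      (norm_inner_le_norm _ _).trans (mul_le_mul h1 (g_le x) (norm_nonneg _) (by positivity))
    simp only [ContinuousLinearMap.comp_apply, fderivInnerCLM_apply,
      ContinuousLinearMap.prod_apply]
    calc _ ≤ _ := norm_add_le _ _
      _ ≤ _ := add_le_add h3 h4
      _ = _ := by ring
  · have hB : 0 ≤ B := (norm_nonneg _).trans (f2 x hx)
    have hB' : 0 ≤ B' := (norm_nonneg _).trans (g2 x hx)
    have hLf : 0 ≤ L * ‖x - y‖ := (norm_nonneg _).trans (f3 x hx y hy)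
    have hLg : 0 ≤ L' * ‖x - y‖ := (norm_nonneg _).trans (g3 x hx y hy)
    refine ContinuousLinearMap.opNorm_le_bound _ ?_ fun v => ?_
    · have : 0 ≤ 2 * B * B' * ‖x - y‖ := by positivity
      linarith
    have h1 : ‖f' y v‖ ≤ B * ‖v‖ := (f' y).le_of_opNorm_le (f2 y hy) v
    have h2 : ‖g' x v‖ ≤ B' * ‖v‖ := (g' x).le_of_opNorm_le (g2 x hx) v
    have h3 : ‖(f' x - f' y) v‖ ≤ L * ‖x - y‖ * ‖v‖ :=
      ContinuousLinearMap.le_of_opNorm_le _ (f3 x hx y hy) v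
    have h4 : ‖(g' x - g' y) v‖ ≤ L' * ‖x - y‖ * ‖v‖ :=
      ContinuousLinearMap.le_of_opNorm_le _ (g3 x hx y hy) v
    have e : ((fderivInnerCLM ℝ (f x, g x)).comp ((f' x).prod (g' x)) -
        (fderivInnerCLM ℝ (f y, g y)).comp ((f' y).prod (g' y))) v =
        (Inner.inner ℝ (f x - f y) (g' x v) + Inner.inner ℝ (f y) ((g' x - g' y) v)) +
        (Inner.inner ℝ ((f' x - f' y) v) (g x) + Inner.inner ℝ (f' y v) (g x - g y)) := by
      simp only [_root_.sub_apply, ContinuousLinearMap.comp_apply,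
        fderivInnerCLM_apply, ContinuousLinearMap.prod_apply, inner_sub_left, inner_sub_right]
      ring
    have i1 : ‖(Inner.inner ℝ (f x - f y) (g' x v) : ℝ)‖ ≤ (B * ‖x - y‖) * (B' * ‖v‖) :=
      (norm_inner_le_norm _ _).trans (mul_le_mul (hflip x y) h2 (norm_nonneg _) (by positivity))
    have i2 : ‖(Inner.inner ℝ (f y) ((g' x - g' y) v) : ℝ)‖ ≤ 1 * (L' * ‖x - y‖ * ‖v‖) :=
      (norm_inner_le_norm _ _).trans (mul_le_mul (f_le y) h4 (norm_nonneg _) zero_le_one)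
    have i3 : ‖(Inner.inner ℝ ((f' x - f' y) v) (g x) : ℝ)‖ ≤ (L * ‖x - y‖ * ‖v‖) * 1 :=
      (norm_inner_le_norm _ _).trans (mul_le_mul h3 (g_le x) (norm_nonneg _) (by positivity))
    have i4 : ‖(Inner.inner ℝ (f' y v) (g x - g y) : ℝ)‖ ≤ (B * ‖v‖) * (B' * ‖x - y‖) :=
      (norm_inner_le_norm _ _).trans (mul_le_mul h1 (hglip x y) (norm_nonneg _) (by positivity))
    rw [e]
    calc _ ≤ _ := norm_add_le _ _
      _ ≤ _ := add_le_add ((norm_add_le _ _).trans (add_le_add i1 i2))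
        ((norm_add_le _ _).trans (add_le_add i3 i4))
      _ = _ := by ring

end Calculus

/-! ### The smoothed normalization -/

section Normalization

variable {H : Type*} [NormedAddCommGroup H] [InnerProductSpace ℝ H]

/-- The smoothed normalization `x ↦ x / (‖x‖ + ε)`. -/
def smoothNormalize (ε : ℝ) (x : H) : H := (‖x‖ + ε)⁻¹ • x

lemma norm_smoothNormalize_lt_one {ε : ℝ} (hε : 0 < ε) (x : H) : ‖smoothNormalize ε x‖ < 1 := by
  have : 0 < ‖x‖ + ε := by positivity
  rw [smoothNormalize, norm_smul, norm_inv, Real.norm_of_nonneg this.le, inv_mul_lt_one₀ this]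
  linarith

/-- The linear map `v ↦ ⟪x, v⟫ x / ‖x‖`, which is `‖x‖` times the orthogonal projection to the line
of `x`. At `x = 0` it is `0`, so that it depends on `x` continuously. -/
def radialPart (x : H) : H →L[ℝ] H := (innerSL ℝ x).smulRight (‖x‖⁻¹ • x)

lemma radialPart_apply (x v : H) : radialPart x v = (inner ℝ x v : ℝ) • ‖x‖⁻¹ • x := rfl

lemma norm_unit_le (x : H) : ‖(‖x‖⁻¹ • x)‖ ≤ 1 := by
  rw [norm_smul, norm_inv, norm_norm]
  exact inv_mul_le_one

lemma norm_radialPart_le (x : H) : ‖radialPart x‖ ≤ ‖x‖ := by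
  refine ContinuousLinearMap.opNorm_le_bound _ (norm_nonneg _) fun v => ?_
  rw [radialPart_apply, norm_smul]
  exact (mul_le_mul (norm_inner_le_norm x v) (norm_unit_le x) (norm_nonneg _)
    (by positivity)).trans (mul_one _).le

lemma norm_radialPart_sub_le (x y : H) : ‖radialPart x - radialPart y‖ ≤ 3 * ‖x - y‖ := by
  rcases eq_or_ne x 0 with rfl | hx
  · have : radialPart (0 : H) = 0 := by ext v; simp [radialPart_apply]
    rw [this, zero_sub, zero_sub, norm_neg, norm_neg]
    linarith [norm_radialPart_le y, norm_nonneg y]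
  have hx' : ‖x‖ ≠ 0 := norm_ne_zero_iff.2 hx
  refine ContinuousLinearMap.opNorm_le_bound _ (by positivity) fun v => ?_
  rcases eq_or_ne y 0 with rfl | hy
  · have : radialPart (0 : H) = 0 := by ext v; simp [radialPart_apply]
    rw [this, sub_zero, sub_zero]
    have := (radialPart x).le_of_opNorm_le (norm_radialPart_le x) v
    nlinarith [mul_nonneg (norm_nonneg x) (norm_nonneg v)]
  have hy' : ‖y‖ ≠ 0 := norm_ne_zero_iff.2 hy
  have e : (radialPart x - radialPart y) v = (inner ℝ (x - y) v : ℝ) • ‖x‖⁻¹ • x +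
      (inner ℝ (‖y‖⁻¹ • y) v : ℝ) • ((‖y‖ - ‖x‖) • ‖x‖⁻¹ • x + (x - y)) := by
    simp only [_root_.sub_apply, radialPart_apply, inner_sub_left,
      real_inner_smul_left, smul_add, smul_sub, smul_smul]
    match_scalars <;> field_simp
    ring
  have h1 : ‖(inner ℝ (x - y) v : ℝ) • ‖x‖⁻¹ • x‖ ≤ (‖x - y‖ * ‖v‖) * 1 := by
    rw [norm_smul]
    exact mul_le_mul (norm_inner_le_norm _ v) (norm_unit_le x) (norm_nonneg _) (by positivity)
  have h2 : ‖(‖y‖ - ‖x‖) • ‖x‖⁻¹ • x + (x - y)‖ ≤ ‖x - y‖ * 1 + ‖x - y‖ := by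
    refine (norm_add_le _ _).trans (add_le_add_left ?_ _)
    rw [norm_smul]
    refine mul_le_mul ?_ (norm_unit_le x) (norm_nonneg _) (norm_nonneg _)
    rw [Real.norm_eq_abs, abs_sub_comm]
    exact abs_norm_sub_norm_le x y
  have h3 : ‖(inner ℝ (‖y‖⁻¹ • y) v : ℝ)‖ ≤ 1 * ‖v‖ :=
    (norm_inner_le_norm _ v).trans (mul_le_mul_of_nonneg_right (norm_unit_le y) (norm_nonneg _))
  rw [e]
  calc _ ≤ _ := norm_add_le _ _
    _ ≤ ‖x - y‖ * ‖v‖ * 1 + (1 * ‖v‖) * (‖x - y‖ * 1 + ‖x - y‖) := by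
      refine add_le_add h1 ?_
      rw [norm_smul]
      exact mul_le_mul h3 h2 (norm_nonneg _) (by positivity)
    _ = _ := by ring

lemma hasFDerivAt_smoothNormalize {ε : ℝ} (hε : 0 < ε) (x : H) :
    HasFDerivAt (smoothNormalize ε) ((‖x‖ + ε)⁻¹ • ContinuousLinearMap.id ℝ H -
      ((‖x‖ + ε) ^ 2)⁻¹ • radialPart x) x := by
  rcases eq_or_ne x 0 with rfl | hx
  · -- The difference quotient at `0` is off by `v (1/ε - 1/(‖v‖ + ε))`, of order `‖v‖²`.
    rw [hasFDerivAt_iff_isLittleO_nhds_zero]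
    have hO : (fun v : H => smoothNormalize ε (0 + v) - smoothNormalize ε 0 -
        ((‖(0 : H)‖ + ε)⁻¹ • ContinuousLinearMap.id ℝ H -
          ((‖(0 : H)‖ + ε) ^ 2)⁻¹ • radialPart (0 : H)) v) =O[nhds 0] fun v => ‖v‖ ^ 2 := by
      refine Asymptotics.IsBigO.of_bound (ε ^ 2)⁻¹ (Filter.Eventually.of_forall fun v => ?_)
      have hN : 0 < ‖v‖ + ε := by positivity
      have e : smoothNormalize ε (0 + v) - smoothNormalize ε 0 -
          ((‖(0 : H)‖ + ε)⁻¹ • ContinuousLinearMap.id ℝ H -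
          ((‖(0 : H)‖ + ε) ^ 2)⁻¹ • radialPart (0 : H)) v =
          (-(‖v‖ * (ε * (‖v‖ + ε))⁻¹)) • v := by
        have e0 : (-(‖v‖ * (ε * (‖v‖ + ε))⁻¹)) = (‖v‖ + ε)⁻¹ - ε⁻¹ := by
          field_simp; ring
        rw [e0]
        simp [smoothNormalize, radialPart_apply, sub_smul]
      rw [e, norm_smul, norm_neg, norm_mul, norm_norm, norm_inv,
        Real.norm_of_nonneg (by positivity : 0 ≤ ε * (‖v‖ + ε)), norm_pow, norm_norm]
      have : (ε * (‖v‖ + ε))⁻¹ ≤ (ε ^ 2)⁻¹ := by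
        apply inv_anti₀ (by positivity)
        nlinarith [norm_nonneg v]
      nlinarith [mul_le_mul_of_nonneg_right this (by positivity : 0 ≤ ‖v‖ ^ 2)]
    exact hO.trans_isLittleO ((Asymptotics.isLittleO_norm_pow_id one_lt_two))
  · have hx' : ‖x‖ ≠ 0 := norm_ne_zero_iff.2 hx
    have hN : ‖x‖ + ε ≠ 0 := by positivity
    have hn : HasFDerivAt (fun y : H => ‖y‖) (‖x‖⁻¹ • innerSL ℝ x) x := by
      have h := ((hasStrictFDerivAt_norm_sq x).hasFDerivAt).sqrt (by positivity)
      simp only [Real.sqrt_sq (norm_nonneg _)] at h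
      convert h using 1
      ext v
      simp
      field_simp
    have h := ((hasDerivAt_inv hN).comp_hasFDerivAt x (hn.add_const ε)).smul (hasFDerivAt_id x)
    refine h.congr_fderiv ?_
    ext v
    simp [radialPart_apply, smul_smul, sub_eq_add_neg]
    match_scalars
    field_simp

/-- Away from `0` the smoothed normalization is smooth; at `0` its derivative is still Lipschitz,
although the norm is not differentiable there. -/
lemma c11On_smoothNormalize {ε : ℝ} (hε : 0 < ε) :
    C11On (2 / ε) (6 / ε ^ 2) (smoothNormalize ε : H → H) Set.univ := by
  have inv_le (x : H) : (‖x‖ + ε)⁻¹ ≤ ε⁻¹ := inv_anti₀ hε (by linarith [norm_nonneg x])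
  have pos (x : H) : 0 < ‖x‖ + ε := by positivity
  have norm_mul_inv_le (x : H) : ‖x‖ * (‖x‖ + ε)⁻¹ ≤ 1 := by
    rw [← div_eq_mul_inv, div_le_one (pos x)]; linarith
  refine ⟨_, fun x _ => hasFDerivAt_smoothNormalize hε x, fun x _ => ?_, fun x _ y _ => ?_⟩
  · have h1 : ‖(‖x‖ + ε)⁻¹ • ContinuousLinearMap.id ℝ H‖ ≤ ε⁻¹ * 1 := by
      rw [norm_smul, Real.norm_of_nonneg (inv_nonneg.2 (pos x).le)]
      exact mul_le_mul (inv_le x) ContinuousLinearMap.norm_id_le (norm_nonneg _) (by positivity)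
    have h2 : ‖((‖x‖ + ε) ^ 2)⁻¹ • radialPart x‖ ≤ ε⁻¹ * 1 := by
      rw [norm_smul, Real.norm_of_nonneg (by have := pos x; positivity)]
      calc _ ≤ ((‖x‖ + ε) ^ 2)⁻¹ * ‖x‖ :=
            mul_le_mul_of_nonneg_left (norm_radialPart_le x) (by have := pos x; positivity)
        _ = (‖x‖ + ε)⁻¹ * (‖x‖ * (‖x‖ + ε)⁻¹) := by rw [sq, mul_inv]; ring
        _ ≤ _ := mul_le_mul (inv_le x) (norm_mul_inv_le x) (by have := pos x; positivity)
            (by positivity)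
    calc _ ≤ _ := norm_sub_le _ _
      _ ≤ _ := add_le_add h1 h2
      _ = _ := by ring
  · set a := (‖x‖ + ε)⁻¹ with ha
    set b := (‖y‖ + ε)⁻¹ with hb
    have ha0 : 0 < a := inv_pos.2 (pos x)
    have hb0 : 0 < b := inv_pos.2 (pos y)
    have hab : |a - b| ≤ a * b * ‖x - y‖ := by
      have e : a - b = a * b * (‖y‖ - ‖x‖) := by
        have := (pos x).ne'; have := (pos y).ne'
        rw [ha, hb]; field_simp; ring
      rw [e, abs_mul, abs_of_pos (mul_pos ha0 hb0)]
      refine mul_le_mul_of_nonneg_left ?_ (by positivity)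
      rw [abs_sub_comm]
      exact abs_norm_sub_norm_le x y
    have e : a • ContinuousLinearMap.id ℝ H - ((‖x‖ + ε) ^ 2)⁻¹ • radialPart x -
        (b • ContinuousLinearMap.id ℝ H - ((‖y‖ + ε) ^ 2)⁻¹ • radialPart y) =
        (a - b) • ContinuousLinearMap.id ℝ H - (a ^ 2 • (radialPart x - radialPart y) +
          ((a - b) * (a + b)) • radialPart y) := by
      rw [ha, hb, ← inv_pow, ← inv_pow]
      module
    have haε : a ≤ ε⁻¹ := inv_le x
    have hbε : b ≤ ε⁻¹ := inv_le y
    have hyb : ‖y‖ * b ≤ 1 := norm_mul_inv_le y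
    have d := norm_nonneg (x - y)
    have habε : a * b ≤ ε⁻¹ ^ 2 := by rw [sq]; gcongr
    have haaε : a ^ 2 ≤ ε⁻¹ ^ 2 := by gcongr
    have h1 : ‖(a - b) • ContinuousLinearMap.id ℝ H‖ ≤ ε⁻¹ ^ 2 * ‖x - y‖ := by
      rw [norm_smul, Real.norm_eq_abs]
      calc _ ≤ |a - b| * 1 :=
            mul_le_mul_of_nonneg_left ContinuousLinearMap.norm_id_le (abs_nonneg _)
        _ ≤ a * b * ‖x - y‖ := by rw [mul_one]; exact hab
        _ ≤ _ := by gcongr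
    have h2 : ‖a ^ 2 • (radialPart x - radialPart y)‖ ≤ ε⁻¹ ^ 2 * (3 * ‖x - y‖) := by
      rw [norm_smul, Real.norm_of_nonneg (by positivity)]
      exact mul_le_mul haaε (norm_radialPart_sub_le x y) (norm_nonneg _) (by positivity)
    have h3 : ‖((a - b) * (a + b)) • radialPart y‖ ≤ 2 * ε⁻¹ ^ 2 * ‖x - y‖ := by
      rw [norm_smul, norm_mul, Real.norm_eq_abs, Real.norm_of_nonneg (by positivity : 0 ≤ a + b)]
      calc _ ≤ (a * b * ‖x - y‖) * (a + b) * ‖y‖ := by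
            gcongr
            exact norm_radialPart_le y
        _ = a * (a + b) * ‖x - y‖ * (‖y‖ * b) := by ring
        _ ≤ a * (a + b) * ‖x - y‖ * 1 := by gcongr
        _ ≤ _ := by
            rw [mul_one]
            refine mul_le_mul_of_nonneg_right ?_ d
            nlinarith
    rw [e]
    calc _ ≤ _ := norm_sub_le _ _
      _ ≤ _ := add_le_add h1 ((norm_add_le _ _).trans (add_le_add h2 h3))
      _ = _ := by rw [inv_pow]; ring

end Normalization

/-! ### The encoder -/

section Encoder

lemma hasDerivAt_tanh (x : ℝ) : HasDerivAt Real.tanh (1 - Real.tanh x ^ 2) x := by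
  have hc : Real.cosh x ≠ 0 := (Real.cosh_pos x).ne'
  have h := (Real.hasDerivAt_sinh x).div (Real.hasDerivAt_cosh x) hc
  have e : Real.tanh = Real.sinh / Real.cosh := by
    ext y; exact Real.tanh_eq_sinh_div_cosh y
  rw [e]
  refine h.congr_deriv ?_
  simp only [Pi.div_apply]
  field_simp

lemma abs_tanh_sub_tanh_le (x y : ℝ) : |Real.tanh x - Real.tanh y| ≤ |x - y| := by
  have := convex_univ.norm_image_sub_le_of_norm_hasDerivWithin_le (f := Real.tanh)
    (f' := fun x => 1 - Real.tanh x ^ 2) (C := 1) (x := y) (y := x)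
    (fun z _ => (hasDerivAt_tanh z).hasDerivWithinAt) (fun z _ => by
      have := Real.tanh_sq_lt_one z
      rw [Real.norm_eq_abs, abs_le]
      constructor <;> nlinarith [sq_nonneg (Real.tanh z)]) (Set.mem_univ _) (Set.mem_univ _)
  simpa using this

variable {p : ℕ}

/-- Coordinatewise multiplication by `d`. -/
def diagonalCLM (d : Fin p → ℝ) : EuclideanSpace ℝ (Fin p) →L[ℝ] EuclideanSpace ℝ (Fin p) :=
  LinearMap.toContinuousLinearMap
    { toFun := fun v => WithLp.toLp 2 fun j => d j * v j
      map_add' := fun u v => by ext j; simp [mul_add]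
      map_smul' := fun r v => by ext j; simp [mul_left_comm] }

lemma diagonalCLM_apply (d : Fin p → ℝ) (v : EuclideanSpace ℝ (Fin p)) (j : Fin p) :
    diagonalCLM d v j = d j * v j := rfl

lemma norm_diagonalCLM_le {d : Fin p → ℝ} {C : ℝ} (hC : 0 ≤ C) (hd : ∀ j, |d j| ≤ C) :
    ‖diagonalCLM d‖ ≤ C := by
  refine ContinuousLinearMap.opNorm_le_bound _ hC fun v => ?_
  refine le_of_sq_le_sq ?_ (by positivity)
  rw [mul_pow, EuclideanSpace.real_norm_sq_eq, EuclideanSpace.real_norm_sq_eq, Finset.mul_sum]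
  refine Finset.sum_le_sum fun j _ => ?_
  rw [diagonalCLM_apply, mul_pow]
  exact mul_le_mul_of_nonneg_right (sq_le_sq.2 (by rw [abs_of_nonneg hC]; exact hd j))
    (sq_nonneg _)

/-- The operator norm of a diagonal map is the largest modulus of its entries, so the constants do
not depend on the dimension. -/
lemma c11On_tanh : C11On 1 2
    (fun u : EuclideanSpace ℝ (Fin p) => (WithLp.toLp 2 fun j => Real.tanh (u j) :
      EuclideanSpace ℝ (Fin p))) Set.univ := by
  have habs (x : ℝ) : |Real.tanh x| ≤ 1 := (Real.abs_tanh_lt_one x).le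
  refine ⟨fun u => diagonalCLM fun j => 1 - Real.tanh (u j) ^ 2, fun u _ => ?_, fun u _ => ?_,
    fun u _ v _ => ?_⟩
  · rw [← hasFDerivWithinAt_univ, hasFDerivWithinAt_euclidean]
    intro j
    rw [hasFDerivWithinAt_univ]
    have h := (hasDerivAt_tanh (u j)).comp_hasFDerivAt u
      (EuclideanSpace.proj (𝕜 := ℝ) j).hasFDerivAt
    refine h.congr_fderiv ?_
    ext v
    simp [diagonalCLM_apply]
  · refine norm_diagonalCLM_le zero_le_one fun j => ?_
    have := habs (u j)
    rw [← sq_le_one_iff_abs_le_one] at this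
    rw [abs_le]
    constructor <;> nlinarith [sq_nonneg (Real.tanh (u j))]
  · have e : (diagonalCLM fun j => 1 - Real.tanh (u j) ^ 2) -
        (diagonalCLM fun j => 1 - Real.tanh (v j) ^ 2) =
        diagonalCLM fun j => Real.tanh (v j) ^ 2 - Real.tanh (u j) ^ 2 := by
      ext w j
      simp only [_root_.sub_apply, PiLp.sub_apply, diagonalCLM_apply]
      ring
    rw [e]
    refine norm_diagonalCLM_le (by positivity) fun j => ?_
    have h1 : |u j - v j| ≤ ‖u - v‖ := by
      simpa using PiLp.norm_apply_le (u - v) j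
    have h2 : |Real.tanh (v j) + Real.tanh (u j)| ≤ 2 :=
      (abs_add_le _ _).trans (by linarith [habs (v j), habs (u j)])
    rw [sq_sub_sq, abs_mul, abs_sub_comm]
    exact mul_le_mul h2 ((abs_tanh_sub_tanh_le _ _).trans h1) (abs_nonneg _) zero_le_two

variable {I : Type*} [Fintype I]

/-- The embedding vector of one word, as a linear function of the parameters. -/
def embCLM (t : I) : EuclideanSpace ℝ (I × Fin p) →L[ℝ] EuclideanSpace ℝ (Fin p) :=
  LinearMap.toContinuousLinearMap
    { toFun := fun w => WithLp.toLp 2 fun j => w (t, j)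
      map_add' := fun u v => by ext j; simp
      map_smul' := fun r v => by ext j; simp }

lemma norm_embCLM_le (t : I) : ‖embCLM (p := p) t‖ ≤ 1 := by
  refine ContinuousLinearMap.opNorm_le_bound _ zero_le_one fun w => ?_
  refine le_of_sq_le_sq ?_ (by positivity)
  rw [one_mul, EuclideanSpace.real_norm_sq_eq, EuclideanSpace.real_norm_sq_eq,
    Fintype.sum_prod_type]
  exact Finset.single_le_sum (f := fun t => ∑ j, w (t, j) ^ 2)
    (fun _ _ => Finset.sum_nonneg fun _ _ => sq_nonneg _) (Finset.mem_univ t)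

/-- Average pooling is an average of linear maps of norm at most `1`. -/
lemma c11On_encode {v : ℕ} (s : Fin v → I) (q : Text v) :
    C11On 1 2 (fun w : EuclideanSpace ℝ (I × Fin p) => encode (fun t j => w (s t, j)) q)
      Set.univ := by
  have hq : (0 : ℝ) < q.1.length := by exact_mod_cast List.length_pos_iff.2 q.2
  let A : EuclideanSpace ℝ (I × Fin p) →L[ℝ] EuclideanSpace ℝ (Fin p) :=
    (q.1.length : ℝ)⁻¹ • ∑ i : Fin q.1.length, embCLM (s (q.1.get i))
  have hA : ‖A‖ ≤ 1 := by
    rw [norm_smul, norm_inv, Real.norm_of_nonneg hq.le, inv_mul_le_one₀ hq]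
    exact (norm_sum_le_of_le _ fun i _ => norm_embCLM_le _).trans (by simp)
  have h := c11On_tanh.comp (c11On_continuousLinearMap A hA) (fun _ => Set.mem_univ _) zero_le_two
  convert h using 1
  · norm_num
  · norm_num
  · funext w
    ext j
    have : A w j = (∑ i : Fin q.1.length, w (s (q.1.get i), j)) / q.1.length := by
      simp only [A, _root_.smul_apply, _root_.sum_apply,
        PiLp.smul_apply, WithLp.ofLp_sum, Finset.sum_apply, smul_eq_mul]
      rw [div_eq_inv_mul]
      rfl
    simp only [encode, this]

end Encoder

/-! ### The relevance score and the loss -/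

section Loss

lemma smoothCos_eq_inner {p : ℕ} (ε : ℝ) (x z : EuclideanSpace ℝ (Fin p)) :
    smoothCos ε x z = inner ℝ (smoothNormalize ε x) (smoothNormalize ε z) := by
  rw [smoothCos, smoothNormalize, smoothNormalize, real_inner_smul_left, real_inner_smul_right,
    div_eq_inv_mul, mul_inv, mul_assoc]

lemma relevance_mem_Ioo {a b p : ℕ} {ε : ℝ} (hε : 0 < ε) (w : Params a b p) (q : Text a)
    (d : Text b) : relevance ε w q d ∈ Set.Ioo (-1 : ℝ) 1 := by
  rw [relevance, smoothCos_eq_inner, Set.mem_Ioo, ← abs_lt]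
  exact (abs_real_inner_le_norm _ _).trans_lt (mul_lt_one_of_nonneg_of_lt_one_left (norm_nonneg _)
    (norm_smoothNormalize_lt_one hε _) (norm_smoothNormalize_lt_one hε _).le)

lemma c11On_relevance {a b p : ℕ} {ε : ℝ} (hε : 0 < ε) (q : Text a) (d : Text b) :
    C11On (4 / ε) (20 / ε ^ 2 + 8 / ε) (fun w : Params a b p => relevance ε w q d) Set.univ := by
  have hn := c11On_smoothNormalize (H := EuclideanSpace ℝ (Fin p)) hε
  have h1 := hn.comp (c11On_encode (p := p) (Sum.inl : Fin a → Fin a ⊕ Fin b) q)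
    (fun _ => Set.mem_univ _) (by positivity)
  have h2 := hn.comp (c11On_encode (p := p) (Sum.inr : Fin b → Fin a ⊕ Fin b) d)
    (fun _ => Set.mem_univ _) (by positivity)
  have h := h1.inner h2 (fun _ => (norm_smoothNormalize_lt_one hε _).le)
    (fun _ => (norm_smoothNormalize_lt_one hε _).le)
  convert h using 1
  · ring
  · ring
  · funext w
    exact smoothCos_eq_inner _ _ _

lemma norm_gradient_eq {H : Type*} [NormedAddCommGroup H] [InnerProductSpace ℝ H]
    [CompleteSpace H] (f : H → ℝ) (x : H) : ‖gradient f x‖ = ‖fderiv ℝ f x‖ :=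
  LinearIsometryEquiv.norm_map _ _

lemma norm_gradient_sub_eq {H : Type*} [NormedAddCommGroup H] [InnerProductSpace ℝ H]
    [CompleteSpace H] (f : H → ℝ) (x y : H) :
    ‖gradient f x - gradient f y‖ = ‖fderiv ℝ f x - fderiv ℝ f y‖ := by
  rw [gradient, gradient, ← map_sub, LinearIsometryEquiv.norm_map]

lemma C11On.smoothOnWith {H : Type*} [NormedAddCommGroup H] [InnerProductSpace ℝ H]
    [CompleteSpace H] {B L : ℝ} {f : H → ℝ} {s : Set H} (hf : C11On B L f s) :
    SmoothOnWith L f s := by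
  obtain ⟨f', h1, -, h3⟩ := hf
  refine ⟨fun u hu => (h1 u hu).differentiableAt, fun u hu v hv => ?_⟩
  rw [norm_gradient_sub_eq, (h1 u hu).fderiv, (h1 v hv).fderiv]
  exact h3 u hu v hv

/-- Since the loss varies by at most `M`, its derivative is at most `M` in modulus somewhere
between `-1/2` and `1/2`, and no point of `(-1, 1)` is farther than `2` from there. -/
lemma IsSmoothBoundedLoss.c11On {K : ℕ} {κ M : ℝ} {l : ℝ → Fin K → ℝ}
    (hl : IsSmoothBoundedLoss κ M l) (y : Fin K) :
    C11On (|M| + 2 * |κ|) |κ| (fun r => l r y) (Set.Ioo (-1) 1) := by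
  obtain ⟨⟨hd, hlip⟩, hM⟩ := hl y
  have hlip' : ∀ u ∈ Set.Ioo (-1 : ℝ) 1, ∀ v ∈ Set.Ioo (-1 : ℝ) 1,
      ‖fderiv ℝ (fun r => l r y) u - fderiv ℝ (fun r => l r y) v‖ ≤ |κ| * ‖u - v‖ := by
    intro u hu v hv
    rw [← norm_gradient_sub_eq]
    exact (hlip u hu v hv).trans (mul_le_mul_of_nonneg_right (le_abs_self κ) (norm_nonneg _))
  refine ⟨_, fun r hr => (hd r hr).hasFDerivAt, fun r hr => ?_, hlip'⟩
  have sub : Set.Icc (-(1 / 2) : ℝ) (1 / 2) ⊆ Set.Ioo (-1) 1 := fun x hx => by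
    constructor <;> linarith [hx.1, hx.2]
  obtain ⟨s, hs, hs'⟩ := exists_deriv_eq_slope (fun r => l r y)
    (by norm_num : (-(1 / 2) : ℝ) < 1 / 2)
    (fun x hx => (hd x (sub hx)).continuousAt.continuousWithinAt)
    (fun x hx => (hd x (sub (Set.Ioo_subset_Icc_self hx))).differentiableWithinAt)
  have hs1 := sub (Set.Ioo_subset_Icc_self hs)
  have h1 : ‖fderiv ℝ (fun r => l r y) s‖ ≤ |M| := by
    rw [← norm_deriv_eq_norm_fderiv, hs', Real.norm_eq_abs]
    norm_num only [sub_neg_eq_add, div_one]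
    have e1 := hM (1 / 2) (by norm_num)
    have e2 := hM (-(1 / 2)) (by norm_num)
    have := le_abs_self M
    rw [abs_le]
    norm_num only at e1 e2 ⊢
    constructor <;> linarith
  have h2 : ‖r - s‖ ≤ 2 := by
    rw [Real.norm_eq_abs, abs_le]
    constructor <;> linarith [hr.1, hr.2, hs1.1, hs1.2]
  calc ‖fderiv ℝ (fun r => l r y) r‖
      = ‖fderiv ℝ (fun r => l r y) s +
          (fderiv ℝ (fun r => l r y) r - fderiv ℝ (fun r => l r y) s)‖ := by
        rw [add_sub_cancel]
    _ ≤ _ := norm_add_le _ _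
    _ ≤ |M| + |κ| * 2 := add_le_add h1 ((hlip' r hr s hs1).trans
        (mul_le_mul_of_nonneg_left h2 (abs_nonneg κ)))
    _ = _ := by ring

lemma c11On_sampleLoss {a b p K : ℕ} {κ M ε : ℝ} (hε : 0 < ε) {l : ℝ → Fin K → ℝ}
    (hl : IsSmoothBoundedLoss κ M l) (z : Sample a b K) :
    C11On ((|M| + 2 * |κ|) * (4 / ε))
      (|κ| * (4 / ε) ^ 2 + (|M| + 2 * |κ|) * (20 / ε ^ 2 + 8 / ε))
      (sampleLoss (p := p) l ε z) Set.univ :=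
  (hl.c11On z.label).comp (c11On_relevance hε z.query z.doc)
    (fun w => relevance_mem_Ioo hε w _ _) (abs_nonneg κ)

lemma C11On.lipschitzWith {E : Type*} [NormedAddCommGroup E] [NormedSpace ℝ E] {B : ℝ≥0} {L : ℝ}
    {f : E → ℝ} (hf : C11On B L f Set.univ) : LipschitzWith B f :=
  LipschitzWith.of_dist_le_mul fun x y => by
    rw [dist_eq_norm, dist_eq_norm]
    exact hf.norm_sub_le x y

end Loss

/-! ### The Smooth Ordinal Search Loss -/

section Sosl

/-- The derivative of the squared positive part; both branches agree at `0`. -/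
lemma hasDerivAt_posPart_sq (x : ℝ) :
    HasDerivAt (fun r : ℝ => max r 0 ^ 2) (2 * max x 0) x := by
  rcases lt_trichotomy x 0 with hx | rfl | hx
  · rw [max_eq_right hx.le, mul_zero]
    refine (hasDerivAt_const x (0 : ℝ)).congr_of_eventuallyEq ?_
    filter_upwards [eventually_lt_nhds hx] with r hr
    simp [max_eq_right hr.le]
  · rw [max_self, mul_zero, hasDerivAt_iff_isLittleO_nhds_zero]
    refine Asymptotics.IsBigO.trans_isLittleO (g := fun h : ℝ => h ^ 2) ?_
      (Asymptotics.isLittleO_pow_id one_lt_two)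
    refine Asymptotics.IsBigO.of_bound 1 (Filter.Eventually.of_forall fun h => ?_)
    rcases le_total h 0 with hh | hh <;> simp [hh, sq_nonneg]
  · rw [max_eq_left hx.le]
    have h := hasDerivAt_pow 2 x
    norm_num at h
    refine h.congr_of_eventuallyEq ?_
    filter_upwards [eventually_gt_nhds hx] with r hr
    simp [max_eq_left hr.le]

lemma sosl_eq_posPart {K : ℕ} (θ : Fin (K + 1) → ℝ) (r : ℝ) (y : Fin K) :
    sosl θ r y = max (r - θ y.succ) 0 ^ 2 + max (θ y.castSucc - r) 0 ^ 2 := by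
  rw [sosl]
  congr 1
  · split_ifs with h
    · rw [max_eq_left (by linarith)]; ring
    · rw [max_eq_right (by linarith)]; ring
  · split_ifs with h
    · rw [max_eq_left (by linarith)]; ring
    · rw [max_eq_right (by linarith)]; ring

/-- The derivative of the loss is twice the difference of `r` and its projection to an interval,
hence `2`-Lipschitz. -/
lemma isSmoothBoundedLoss_sosl {K : ℕ} {θ : Fin (K + 1) → ℝ} (hθ : StrictMono θ) (h0 : θ 0 = -1)
    (h1 : θ (Fin.last K) = 1) : IsSmoothBoundedLoss 2 4 (sosl θ) := by
  intro y
  have hlt : θ y.castSucc < θ y.succ := hθ y.castSucc_lt_succ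
  have hlo : -1 ≤ θ y.castSucc := h0 ▸ hθ.monotone (Fin.zero_le _)
  have hhi : θ y.succ ≤ 1 := h1 ▸ hθ.monotone (Fin.le_last _)
  have hder (r : ℝ) : HasDerivAt (fun r => sosl θ r y)
      (2 * max (r - θ y.succ) 0 - 2 * max (θ y.castSucc - r) 0) r := by
    have d1 := (hasDerivAt_posPart_sq (r - θ y.succ)).comp r ((hasDerivAt_id r).sub_const _)
    have d2 := (hasDerivAt_posPart_sq (θ y.castSucc - r)).comp r ((hasDerivAt_id r).const_sub _)
    refine ((d1.add d2).congr_deriv (by ring)).congr_of_eventuallyEq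
      (Filter.Eventually.of_forall fun s => ?_)
    simp [sosl_eq_posPart]
  refine ⟨⟨fun r _ => (hder r).differentiableAt, fun u _ v _ => ?_⟩, fun r hr => ?_⟩
  · rw [(hder u).hasGradientAt'.gradient, (hder v).hasGradientAt'.gradient, Real.norm_eq_abs,
      Real.norm_eq_abs]
    have key {s t : ℝ} (hst : s ≤ t) :
        |(2 * max (t - θ y.succ) 0 - 2 * max (θ y.castSucc - t) 0) -
          (2 * max (s - θ y.succ) 0 - 2 * max (θ y.castSucc - s) 0)| ≤ 2 * |t - s| := by
      rw [abs_of_nonneg (sub_nonneg.2 hst), abs_le]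
      constructor <;>
      rcases max_cases (t - θ y.succ) 0 with ⟨e1, _⟩ | ⟨e1, _⟩ <;>
      rcases max_cases (θ y.castSucc - t) 0 with ⟨e2, _⟩ | ⟨e2, _⟩ <;>
      rcases max_cases (s - θ y.succ) 0 with ⟨e3, _⟩ | ⟨e3, _⟩ <;>
      rcases max_cases (θ y.castSucc - s) 0 with ⟨e4, _⟩ | ⟨e4, _⟩ <;>
      rw [e1, e2, e3, e4] <;> linarith
    rcases le_total u v with h | h
    · rw [abs_sub_comm, abs_sub_comm u v]
      exact key h
    · exact key h
  · rw [sosl_eq_posPart]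
    refine ⟨by positivity, ?_⟩
    obtain ⟨hr1, hr2⟩ := hr
    rcases max_cases (r - θ y.succ) 0 with ⟨e1, _⟩ | ⟨e1, _⟩ <;>
    rcases max_cases (θ y.castSucc - r) 0 with ⟨e2, _⟩ | ⟨e2, _⟩ <;>
    rw [e1, e2] <;> nlinarith

end Sosl

/-! ### Growth of the amplification factors -/

section Growth

lemma one_add_div_mul_rpow_le {m x : ℝ} (hm : 0 < m) (hx : 0 ≤ x) :
    (1 + x / (m + 1)) * m ^ x ≤ (m + 1) ^ x := by
  have h1 : 1 / (m + 1) ≤ Real.log ((m + 1) / m) := by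
    refine le_trans (le_of_eq ?_) (Real.one_sub_inv_le_log_of_pos (by positivity))
    field_simp
    ring
  have h2 : 1 + x / (m + 1) ≤ ((m + 1) / m) ^ x := by
    rw [Real.rpow_def_of_pos (by positivity)]
    calc 1 + x / (m + 1) = x * (1 / (m + 1)) + 1 := by ring
      _ ≤ Real.log ((m + 1) / m) * x + 1 := by nlinarith
      _ ≤ _ := Real.add_one_le_exp _
  calc (1 + x / (m + 1)) * m ^ x ≤ ((m + 1) / m) ^ x * m ^ x := by gcongr
    _ = (m + 1) ^ x := by
      rw [← Real.mul_rpow (by positivity) hm.le, div_mul_cancel₀ _ hm.ne']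

/-- Comparison of `∑ t⁻¹ (T / t) ^ x` with the integral, by telescoping. -/
lemma sum_Ico_div_rpow_le {x : ℝ} (hx : 0 < x) {t₀ T : ℕ} (ht₀ : 1 ≤ t₀) :
    ∑ t ∈ Finset.Ico t₀ T, 1 / ((t : ℝ) + 1) * ((T : ℝ) / (t + 1)) ^ x ≤
      ((T : ℝ) / t₀) ^ x / x := by
  rcases lt_or_ge T t₀ with h | h
  · rw [Finset.Ico_eq_empty_of_le h.le, Finset.sum_empty]
    positivity
  have ht₀' : (0 : ℝ) < t₀ := by exact_mod_cast ht₀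
  have tele : ∑ t ∈ Finset.Ico t₀ T, 1 / ((t : ℝ) + 1) * (((t : ℝ) + 1) ^ x)⁻¹ ≤
      (((t₀ : ℝ) ^ x)⁻¹ - ((T : ℝ) ^ x)⁻¹) / x := by
    induction T, h using Nat.le_induction with
    | base => simp
    | succ T h ih =>
      have hT : (0 : ℝ) < T := ht₀'.trans_le (by exact_mod_cast h)
      rw [Finset.sum_Ico_succ_top h]
      have key := one_add_div_mul_rpow_le hT hx.le
      have p1 : 0 < (T : ℝ) ^ x := by positivity
      have p2 : 0 < ((T : ℝ) + 1) ^ x := by positivity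
      have step : 1 / ((T : ℝ) + 1) * (((T : ℝ) + 1) ^ x)⁻¹ ≤
          (((T : ℝ) ^ x)⁻¹ - (((T : ℝ) + 1) ^ x)⁻¹) / x := by
        have k2 : (1 + x / ((T : ℝ) + 1)) * (((T : ℝ) + 1) ^ x)⁻¹ ≤ ((T : ℝ) ^ x)⁻¹ := by
          rw [← div_eq_mul_inv, div_le_iff₀ p2, inv_mul_eq_div, le_div_iff₀ p1]
          exact key
        rw [le_div_iff₀ hx]
        calc _ = (1 + x / ((T : ℝ) + 1)) * (((T : ℝ) + 1) ^ x)⁻¹ - (((T : ℝ) + 1) ^ x)⁻¹ := by ring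
          _ ≤ _ := by linarith
      push_cast
      calc _ ≤ _ := add_le_add ih step
        _ = _ := by ring
  calc ∑ t ∈ Finset.Ico t₀ T, 1 / ((t : ℝ) + 1) * ((T : ℝ) / (t + 1)) ^ x
      = (T : ℝ) ^ x * ∑ t ∈ Finset.Ico t₀ T, 1 / ((t : ℝ) + 1) * (((t : ℝ) + 1) ^ x)⁻¹ := by
        rw [Finset.mul_sum]
        refine Finset.sum_congr rfl fun t _ => ?_
        rw [Real.div_rpow (by positivity) (by positivity)]
        ring
    _ ≤ (T : ℝ) ^ x * ((((t₀ : ℝ) ^ x)⁻¹ - ((T : ℝ) ^ x)⁻¹) / x) := by gcongr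
    _ ≤ (T : ℝ) ^ x * (((t₀ : ℝ) ^ x)⁻¹ / x) := by
        gcongr
        have : 0 ≤ ((T : ℝ) ^ x)⁻¹ := by positivity
        linarith
    _ = _ := by
        rw [Real.div_rpow (by positivity) (by positivity)]
        ring

end Growth

/-! ### Uniform stability of SGD -/

section Stability

variable {H : Type*} [NormedAddCommGroup H] [InnerProductSpace ℝ H] [CompleteSpace H]

lemma norm_gradient_le_of_lipschitz {α : ℝ≥0} {f : H → ℝ} (hf : LipschitzWith α f) (x : H) :
    ‖gradient f x‖ ≤ α := by
  rw [norm_gradient_eq]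
  exact norm_fderiv_le_of_lipschitz ℝ hf

/-- Two runs of gradient descent whose objectives agree except at the steps in `P`. A discrepancy
`2 α c / (t + 1)` that enters at step `t` is amplified by the later steps by at most
`∏ (1 + γ c / s) ≤ (T / (t + 1)) ^ (γ c)`. -/
lemma norm_gradientSteps_sub_le {c γ : ℝ} {α : ℝ≥0} (hc : 0 < c) (hγ : 0 < γ) (w₀ : H) (T : ℕ)
    (f g : Fin T → H → ℝ) (P : Fin T → Prop) [DecidablePred P] (hP : ∀ t, ¬ P t → f t = g t)
    (hf : ∀ t, LipschitzWith α (f t) ∧ SmoothOnWith γ (f t) Set.univ)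
    (hg : ∀ t, LipschitzWith α (g t)) :
    ‖gradientSteps c w₀ T f - gradientSteps c w₀ T g‖ ≤
      ∑ t, if P t then 2 * c * α * (1 / ((t : ℝ) + 1) * ((T : ℝ) / (t + 1)) ^ (γ * c)) else 0 := by
  induction T with
  | zero => simp [gradientSteps]
  | succ T ih =>
    have ih := ih (fun t => f t.castSucc) (fun t => g t.castSucc) (fun t => P t.castSucc)
      (fun t => hP _) (fun t => hf _) (fun t => hg _)
    rw [gradientSteps, gradientSteps, Fin.sum_univ_castSucc]
    simp only [Fin.val_castSucc, Fin.val_last]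
    set w := gradientSteps c w₀ T fun t => f t.castSucc
    set w' := gradientSteps c w₀ T fun t => g t.castSucc
    set η : ℝ := c / ((T + 1 : ℕ) : ℝ) with hη
    have hη0 : 0 < η := by positivity
    have step : ‖(w - η • gradient (f (Fin.last T)) w) - (w' - η • gradient (g (Fin.last T)) w')‖ ≤
        (1 + η * γ) * ‖w - w'‖ + if P (Fin.last T) then 2 * η * α else 0 := by
      have e : (w - η • gradient (f (Fin.last T)) w) - (w' - η • gradient (g (Fin.last T)) w') =
          (w - w') - η • (gradient (f (Fin.last T)) w - gradient (g (Fin.last T)) w') := by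
        module
      rw [e]
      refine (norm_sub_le _ _).trans ?_
      rw [norm_smul, Real.norm_of_nonneg hη0.le]
      split_ifs with h
      · have h1 : ‖gradient (f (Fin.last T)) w - gradient (g (Fin.last T)) w'‖ ≤ α + α :=
          (norm_sub_le _ _).trans (add_le_add (norm_gradient_le_of_lipschitz (hf _).1 _)
            (norm_gradient_le_of_lipschitz (hg _) _))
        have h2 := mul_le_mul_of_nonneg_left h1 hη0.le
        have h3 : 0 ≤ η * γ * ‖w - w'‖ := by positivity
        linarith
      · rw [← hP _ h]
        have h1 := mul_le_mul_of_nonneg_left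
          ((hf (Fin.last T)).2.2 w (Set.mem_univ _) w' (Set.mem_univ _)) hη0.le
        linarith
    refine step.trans (add_le_add ?_ ?_)
    · refine (mul_le_mul_of_nonneg_left ih (by positivity)).trans ?_
      rw [Finset.mul_sum]
      refine Finset.sum_le_sum fun t _ => ?_
      split_ifs with h
      · have hT : (0 : ℝ) < T := by exact_mod_cast t.pos
        have key := one_add_div_mul_rpow_le hT (by positivity : 0 ≤ γ * c)
        have e : η * γ = γ * c / (T + 1) := by rw [hη]; push_cast; ring
        rw [e, Nat.cast_succ, Real.div_rpow (by positivity) (by positivity),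
          Real.div_rpow (by positivity) (by positivity)]
        calc _ = (2 * c * α * (1 / ((t : ℝ) + 1)) / ((t : ℝ) + 1) ^ (γ * c)) *
              ((1 + γ * c / (T + 1)) * (T : ℝ) ^ (γ * c)) := by ring
          _ ≤ (2 * c * α * (1 / ((t : ℝ) + 1)) / ((t : ℝ) + 1) ^ (γ * c)) *
              (((T : ℝ) + 1) ^ (γ * c)) := by gcongr
          _ = _ := by ring
      · simp
    · split_ifs with h
      · rw [Nat.cast_succ, div_self (by positivity), Real.one_rpow, hη, Nat.cast_succ]
        exact le_of_eq (by ring)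
      · exact le_rfl

lemma expect_ite_apply_eq {T n : ℕ} (t : Fin T) (i : Fin n) (b : ℝ) :
    (Finset.expect Finset.univ fun ι : Fin T → Fin n => if ι t = i then b else 0) = b / n := by
  have : Nonempty (Fin n) := ⟨i⟩
  rw [Fintype.expect_equiv (Equiv.funSplitAt t (Fin n)) (fun ι => if ι t = i then b else 0)
    (fun q : Fin n × ({j // j ≠ t} → Fin n) => if q.1 = i then b else 0) (fun ι => rfl),
    ← Finset.univ_product_univ, Finset.expect_product]
  have inner_const (j : Fin n) : (Finset.expect Finset.univ fun _ : {j // j ≠ t} → Fin n =>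
      if j = i then b else 0) = if j = i then b else 0 :=
    Finset.expect_const Finset.univ_nonempty _
  simp only [inner_const]
  rw [Fintype.expect_eq_sum_div_card]
  simp

/-- The stability constant of `T` steps of SGD with step sizes `c / t` on samples of size `n`, for a
loss with values in `[0, M]` that is `α`-Lipschitz and `γ`-smooth. The summand `1` makes it
positive. -/
def stabilityConst (M : ℝ) (α : ℝ≥0) (γ : ℝ) : ℝ := 2 * |M| + 2 * α ^ 2 / γ + 1

/-- **Uniform stability of SGD**. Two samples that differ at index `i` only give the same run up to
the first use of `i`. If `i` is used within the first `t₀` steps, the losses differ by at most `M`;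
otherwise by at most `α` times the distance of the parameters, in which only uses of `i` after step
`t₀` count. Each step uses `i` with probability `1 / n`, and `t₀ = ⌈T ^ (γ c / (γ c + 1))⌉` balances
the two contributions. -/
lemma uniform_stability_sgd {Z : Type*} {loss : Z → H → ℝ} {M c γ : ℝ} {α : ℝ≥0} (hc : 0 < c)
    (hγ : 0 < γ) (hM : ∀ z w, 0 ≤ loss z w ∧ loss z w ≤ M)
    (hloss : ∀ z, LipschitzWith α (loss z) ∧ SmoothOnWith γ (loss z) Set.univ) (w₀ : H) {T n : ℕ}
    (hT : 1 ≤ T) (S S' : Fin n → Z) (i : Fin n) (hS : ∀ k, k ≠ i → S k = S' k) (z : Z) :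
    (Finset.expect Finset.univ fun ι : Fin T → Fin n =>
      |loss z (gradientSteps c w₀ T fun t => loss (S (ι t))) -
        loss z (gradientSteps c w₀ T fun t => loss (S' (ι t)))|) ≤
      stabilityConst M α γ * ((T : ℝ) ^ (1 - 1 / (γ * c + 1)) / n) := by
  set x := γ * c with hx
  have hx0 : 0 < x := by positivity
  set q := 1 - 1 / (x + 1) with hq
  have hT0 : (0 : ℝ) < T := by exact_mod_cast hT
  have hn : (0 : ℝ) < n := by exact_mod_cast i.pos
  have hM0 : 0 ≤ M := (hM z w₀).1.trans (hM z w₀).2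
  set t₀ : ℕ := ⌈(T : ℝ) ^ q⌉₊
  have hTq : 1 ≤ (T : ℝ) ^ q := Real.one_le_rpow (by exact_mod_cast hT) (by
    rw [hq, sub_nonneg, div_le_one (by positivity)]; linarith)
  have ht₀1 : 1 ≤ t₀ := Nat.one_le_ceil_iff.2 (by linarith)
  let r : ℕ → ℝ := fun t => 1 / ((t : ℝ) + 1) * ((T : ℝ) / (t + 1)) ^ x
  have hr (t : ℕ) : 0 ≤ r t := by positivity
  let b : ℕ → ℝ := fun t => if t < t₀ then M else α * (2 * c * α * r t)
  have hb (t : ℕ) : 0 ≤ b t := by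
    have := hr t
    simp only [b]; split_ifs <;> positivity
  have pointwise (ι : Fin T → Fin n) :
      |loss z (gradientSteps c w₀ T fun t => loss (S (ι t))) -
        loss z (gradientSteps c w₀ T fun t => loss (S' (ι t)))| ≤
      ∑ t : Fin T, if ι t = i then b t else 0 := by
    have nonneg : ∀ t ∈ Finset.univ, 0 ≤ if ι t = i then b (t : ℕ) else 0 := fun t _ => by
      split_ifs
      · exact hb t
      · exact le_rfl
    by_cases h : ∃ t : Fin T, ι t = i ∧ (t : ℕ) < t₀
    · obtain ⟨t, ht, htt⟩ := h
      have h1 := Finset.single_le_sum nonneg (Finset.mem_univ t)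
      simp only [ht, if_true, b, htt] at h1
      refine le_trans ?_ h1
      have e1 := hM z (gradientSteps c w₀ T fun t => loss (S (ι t)))
      have e2 := hM z (gradientSteps c w₀ T fun t => loss (S' (ι t)))
      rw [abs_le]
      constructor <;> linarith [e1.1, e1.2, e2.1, e2.2]
    · push Not at h
      have h1 := norm_gradientSteps_sub_le hc hγ w₀ T (fun t => loss (S (ι t)))
        (fun t => loss (S' (ι t))) (fun t => ι t = i)
        (fun t ht => by simp only [hS _ ht]) (fun t => hloss _) (fun t => (hloss _).1)
      have h2 := (hloss z).1.dist_le_mul (gradientSteps c w₀ T fun t => loss (S (ι t)))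
        (gradientSteps c w₀ T fun t => loss (S' (ι t)))
      rw [Real.dist_eq, dist_eq_norm] at h2
      refine h2.trans ((mul_le_mul_of_nonneg_left h1 α.2).trans ?_)
      rw [Finset.mul_sum]
      refine Finset.sum_le_sum fun t _ => ?_
      split_ifs with ht
      · simp only [b, if_neg (not_lt.2 (h t ht))]
        exact le_rfl
      · simp
  have sum_b : ∑ t : Fin T, b t ≤ stabilityConst M α γ * (T : ℝ) ^ q := by
    rw [Fin.sum_univ_eq_sum_range]
    have h1 : ∑ t ∈ Finset.range T, b t ≤
        ∑ t ∈ Finset.range t₀, M + ∑ t ∈ Finset.Ico t₀ T, α * (2 * c * α * r t) := by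
      simp only [b]
      rw [Finset.sum_ite]
      refine add_le_add (Finset.sum_le_sum_of_subset_of_nonneg (fun t ht => ?_) fun _ _ _ => hM0)
        (le_of_eq (Finset.sum_congr ?_ fun _ _ => rfl))
      · exact Finset.mem_range.2 (Finset.mem_filter.1 ht).2
      · ext t
        simp only [Finset.mem_filter, Finset.mem_range, Finset.mem_Ico]
        omega
    have h2 : ∑ t ∈ Finset.Ico t₀ T, r t ≤ (T : ℝ) ^ q / x := by
      refine (sum_Ico_div_rpow_le hx0 ht₀1).trans ?_
      gcongr
      have : (T : ℝ) / t₀ ≤ (T : ℝ) ^ (1 - q) := by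
        rw [Real.rpow_sub hT0, Real.rpow_one]
        gcongr
        exact Nat.le_ceil _
      calc ((T : ℝ) / t₀) ^ x ≤ ((T : ℝ) ^ (1 - q)) ^ x := by gcongr
        _ = (T : ℝ) ^ q := by
          rw [← Real.rpow_mul hT0.le]
          congr 1
          rw [hq]
          field_simp
          ring
    have h3 : (t₀ : ℝ) ≤ 2 * (T : ℝ) ^ q := by
      have := (Nat.ceil_lt_add_one (by positivity : 0 ≤ (T : ℝ) ^ q)).le
      linarith
    rw [← Finset.mul_sum, ← Finset.mul_sum, Finset.sum_const, Finset.card_range, nsmul_eq_mul] at h1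
    calc _ ≤ _ := h1
      _ ≤ 2 * (T : ℝ) ^ q * M + α * (2 * c * α * ((T : ℝ) ^ q / x)) := by gcongr
      _ = (2 * M + 2 * α ^ 2 / γ) * (T : ℝ) ^ q := by rw [hx]; field_simp
      _ ≤ _ := by
        rw [stabilityConst, abs_of_nonneg hM0]
        exact mul_le_mul_of_nonneg_right (le_add_of_nonneg_right zero_le_one) (by positivity)
  calc _ ≤ Finset.expect Finset.univ fun ι : Fin T → Fin n =>
        ∑ t : Fin T, if ι t = i then b t else 0 := Finset.expect_le_expect fun ι _ => pointwise ι
    _ = ∑ t : Fin T, b t / n := by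
      rw [Finset.expect_sum_comm]
      exact Finset.sum_congr rfl fun t _ => expect_ite_apply_eq t i _
    _ = (∑ t : Fin T, b t) / n := (Finset.sum_div _ _ _).symm
    _ ≤ stabilityConst M α γ * (T : ℝ) ^ q / n := by gcongr
    _ = _ := by ring

end Stability

/-! ### McDiarmid's inequality -/

section McDiarmid

lemma insertNth_congr {X : Type*} {n : ℕ} (i : Fin (n + 1)) (x y : X) (r : Fin n → X)
    (k : Fin (n + 1)) (hk : k ≠ i) :
    (i.insertNth x r : Fin (n + 1) → X) k = (i.insertNth y r : Fin (n + 1) → X) k := by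
  obtain ⟨j, rfl⟩ := Fin.exists_succAbove_eq hk
  simp

variable {X : Type*} [MeasurableSpace X] (μ : Measure X) [IsProbabilityMeasure μ]

lemma integrable_of_measurable_of_abs_le {Ω : Type*} [MeasurableSpace Ω] {P : Measure Ω}
    [IsFiniteMeasure P] {f : Ω → ℝ} {B : ℝ} (hf : Measurable f) (hB : ∀ x, |f x| ≤ B) :
    Integrable f P :=
  Integrable.of_bound hf.aestronglyMeasurable B (Filter.Eventually.of_forall hB)

lemma abs_integral_le_of_abs_le {Ω : Type*} [MeasurableSpace Ω] {P : Measure Ω}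
    [IsProbabilityMeasure P] {f : Ω → ℝ} {B : ℝ} (hB : ∀ x, |f x| ≤ B) : |∫ x, f x ∂P| ≤ B := by
  simpa using norm_integral_le_of_norm_le_const (μ := P) (f := f)
    (Filter.Eventually.of_forall fun x => (Real.norm_eq_abs (f x)).trans_le (hB x))

lemma integral_pi_eq_integral_insertNth {n : ℕ} (i : Fin (n + 1)) (f : (Fin (n + 1) → X) → ℝ) :
    ∫ S, f S ∂(Measure.pi fun _ => μ) =
      ∫ q : X × (Fin n → X), f (i.insertNth q.1 q.2) ∂(μ.prod (Measure.pi fun _ => μ)) :=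
  (((measurePreserving_piFinSuccAbove (fun _ : Fin (n + 1) => μ) i).symm).integral_comp' f).symm

lemma measurable_insertNth {n : ℕ} (i : Fin (n + 1)) :
    Measurable fun q : X × (Fin n → X) => (i.insertNth q.1 q.2 : Fin (n + 1) → X) :=
  (MeasurableEquiv.piFinSuccAbove (fun _ => X) i).symm.measurable

/-- The exponential moment bound of McDiarmid's inequality. Averaging over all coordinates but the
first leaves a function `g` of one variable, to which Hoeffding's lemma applies; for each value of
the first coordinate, the deviation of `f` from `g` is a function of the remaining ones. -/
lemma integral_exp_boundedDifferences_le {n : ℕ} (f : (Fin n → X) → ℝ) (hf : Measurable f) {B : ℝ}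
    (hB : ∀ S, |f S| ≤ B) (d : Fin n → ℝ)
    (hd : ∀ i S S', (∀ k, k ≠ i → S k = S' k) → f S - f S' ≤ d i) (t : ℝ) :
    ∫ S, Real.exp (t * (f S - ∫ S', f S' ∂(Measure.pi fun _ => μ))) ∂(Measure.pi fun _ => μ) ≤
      Real.exp ((∑ i, (d i / 2) ^ 2) * t ^ 2 / 2) := by
  induction n with
  | zero =>
    have e : f = fun _ => f default := funext fun S => congrArg f (Subsingleton.elim _ _)
    rw [e]
    simp
  | succ n ih =>
    obtain ⟨x₀⟩ : Nonempty X := nonempty_of_isProbabilityMeasure μ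
    set ν : Measure (Fin n → X) := Measure.pi fun _ => μ
    let h : X × (Fin n → X) → ℝ := fun q => f ((0 : Fin (n + 1)).insertNth q.1 q.2)
    have hh : Measurable h := hf.comp (measurable_insertNth 0)
    have hhB (q) : |h q| ≤ B := hB _
    have hhx (x : X) : Measurable fun r => h (x, r) := hh.comp measurable_prodMk_left
    let g : X → ℝ := fun x => ∫ r, h (x, r) ∂ν
    have hg : Measurable g := hh.stronglyMeasurable.integral_prod_right'.measurable
    have hgB (x : X) : |g x| ≤ B := abs_integral_le_of_abs_le fun _ => hhB _
    have mean : ∫ S', f S' ∂(Measure.pi fun _ => μ) = ∫ x, g x ∂μ := by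
      rw [integral_pi_eq_integral_insertNth μ 0,
        integral_prod _ (integrable_of_measurable_of_abs_le hh hhB)]
    set m := ∫ x, g x ∂μ with hm
    have g_diff (x y : X) : g x - g y ≤ d 0 := by
      rw [← integral_sub (integrable_of_measurable_of_abs_le (hhx x) fun _ => hhB _)
        (integrable_of_measurable_of_abs_le (hhx y) fun _ => hhB _)]
      refine (integral_mono ((integrable_of_measurable_of_abs_le (hhx x) fun _ => hhB _).sub
        (integrable_of_measurable_of_abs_le (hhx y) fun _ => hhB _))
        (integrable_const (d 0)) fun r => hd 0 _ _ (insertNth_congr 0 x y r)).trans ?_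
      simp
    have bdd : BddBelow (Set.range g) :=
      ⟨-B, by rintro _ ⟨x, rfl⟩; exact neg_le_of_abs_le (hgB x)⟩
    have g_mem (x : X) : g x ∈ Set.Icc (sInf (Set.range g)) (sInf (Set.range g) + d 0) := by
      refine ⟨csInf_le bdd ⟨x, rfl⟩, ?_⟩
      rw [← sub_le_iff_le_add]
      refine le_csInf ⟨_, x₀, rfl⟩ ?_
      rintro _ ⟨y, rfl⟩
      linarith [g_diff x y]
    have hoeffding : ∫ x, Real.exp (t * (g x - m)) ∂μ ≤ Real.exp ((d 0 / 2) ^ 2 * t ^ 2 / 2) := by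
      have := (ProbabilityTheory.hasSubgaussianMGF_of_mem_Icc (μ := μ) hg.aemeasurable
        (Filter.Eventually.of_forall g_mem)).mgf_le t
      simpa [ProbabilityTheory.mgf, div_pow] using this
    have inner_le (x : X) : ∫ r, Real.exp (t * (h (x, r) - g x)) ∂ν ≤
        Real.exp ((∑ i : Fin n, (d i.succ / 2) ^ 2) * t ^ 2 / 2) := by
      refine ih (fun r => h (x, r)) (hhx x) (fun r => hhB _) (fun i => d i.succ)
        (fun i r r' hr => hd i.succ _ _ fun k hk => ?_)
      induction k using Fin.cases with
      | zero => simp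
      | succ k =>
        have := hr k fun e => hk (e ▸ rfl)
        simpa [Fin.insertNth_zero'] using this
    have exp_int : Integrable (fun q => Real.exp (t * (h q - m))) (μ.prod ν) :=
      ProbabilityTheory.integrable_exp_mul_of_mem_Icc (a := -B - m) (b := B - m)
        (hh.sub_const m).aemeasurable (Filter.Eventually.of_forall fun q => by
          have := abs_le.1 (hhB q)
          constructor <;> linarith [this.1, this.2])
    have exp_int_g : Integrable (fun x => Real.exp (t * (g x - m))) μ :=
      ProbabilityTheory.integrable_exp_mul_of_mem_Icc (a := -B - m) (b := B - m)
        (hg.sub_const m).aemeasurable (Filter.Eventually.of_forall fun x => by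
          have := abs_le.1 (hgB x)
          constructor <;> linarith [this.1, this.2])
    rw [mean, integral_pi_eq_integral_insertNth μ 0]
    change ∫ q, Real.exp (t * (h q - m)) ∂(μ.prod ν) ≤ _
    rw [integral_prod _ exp_int, Fin.sum_univ_succ]
    calc ∫ x, ∫ r, Real.exp (t * (h (x, r) - m)) ∂ν ∂μ
        ≤ ∫ x, Real.exp (t * (g x - m)) *
            Real.exp ((∑ i : Fin n, (d i.succ / 2) ^ 2) * t ^ 2 / 2) ∂μ := by
          refine integral_mono exp_int.integral_prod_left (exp_int_g.mul_const _) fun x => ?_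
          have e (r : Fin n → X) : Real.exp (t * (h (x, r) - m)) =
              Real.exp (t * (g x - m)) * Real.exp (t * (h (x, r) - g x)) := by
            rw [← Real.exp_add]
            ring_nf
          simp only [e]
          rw [integral_const_mul]
          exact mul_le_mul_of_nonneg_left (inner_le x) (Real.exp_pos _).le
      _ ≤ Real.exp ((d 0 / 2) ^ 2 * t ^ 2 / 2) *
            Real.exp ((∑ i : Fin n, (d i.succ / 2) ^ 2) * t ^ 2 / 2) := by
          rw [integral_mul_const]
          exact mul_le_mul_of_nonneg_right hoeffding (Real.exp_pos _).le
      _ = _ := by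
          rw [← Real.exp_add]
          ring_nf

/-- **McDiarmid's inequality** for a bounded function of independent, identically distributed
variables. -/
lemma measureReal_boundedDifferences_le {n : ℕ} (f : (Fin n → X) → ℝ) (hf : Measurable f) {B : ℝ}
    (hB : ∀ S, |f S| ≤ B) (d : Fin n → ℝ)
    (hd : ∀ i S S', (∀ k, k ≠ i → S k = S' k) → f S - f S' ≤ d i) {s : ℝ} (hs : 0 ≤ s) :
    (Measure.pi fun _ => μ).real {S | s ≤ f S - ∫ S', f S' ∂(Measure.pi fun _ => μ)} ≤
      Real.exp (-s ^ 2 / (2 * ∑ i, (d i / 2) ^ 2)) := by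
  set P : Measure (Fin n → X) := Measure.pi fun _ => μ
  have hmean := abs_le.1 (abs_integral_le_of_abs_le (P := P) hB)
  have sub : ProbabilityTheory.HasSubgaussianMGF (fun S => f S - ∫ S', f S' ∂P)
      (Real.toNNReal (∑ i, (d i / 2) ^ 2)) P := by
    refine ⟨fun t => ?_, fun t => ?_⟩
    · exact ProbabilityTheory.integrable_exp_mul_of_mem_Icc (a := -B - ∫ S', f S' ∂P)
        (b := B - ∫ S', f S' ∂P) (hf.sub_const _).aemeasurable
        (Filter.Eventually.of_forall fun S => by
          have := abs_le.1 (hB S)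
          constructor <;> linarith [this.1, this.2])
    · rw [Real.coe_toNNReal _ (Finset.sum_nonneg fun _ _ => sq_nonneg _)]
      exact integral_exp_boundedDifferences_le μ f hf hB d hd t
  have := sub.measure_ge_le hs
  rwa [Real.coe_toNNReal _ (Finset.sum_nonneg fun _ _ => sq_nonneg _)] at this

end McDiarmid

/-! ### Generalization from uniform stability -/

section Generalization

variable {X : Type*} [MeasurableSpace X] (μ : Measure X) [IsProbabilityMeasure μ]

/-- The training error at index `i` is, in the mean, the error on a fresh example `z` of the
algorithm run with `z` in the place of the `i`-th example; hence it is within `β` of the expected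
error. -/
lemma integral_sub_apply_le_of_stable {n : ℕ} {L : (Fin n → X) → X → ℝ}
    (hL : Measurable (Function.uncurry L)) {M β : ℝ} (hM : ∀ S z, |L S z| ≤ M) (i : Fin n)
    (hβ : ∀ S S', (∀ k, k ≠ i → S k = S' k) → ∀ z, L S z - L S' z ≤ β) :
    ∫ S, (∫ z, L S z ∂μ - L S (S i)) ∂(Measure.pi fun _ => μ) ≤ β := by
  obtain _ | n := n
  · exact i.elim0
  set ν : Measure (Fin n → X) := Measure.pi fun _ => μ
  let ins : X → (Fin n → X) → Fin (n + 1) → X := fun x r => i.insertNth x r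
  have hins : Measurable fun q : X × (Fin n → X) => ins q.1 q.2 := measurable_insertNth i
  -- The functions of `(r, (x, z))` below: the loss at `z` of the run with `x`, or `z`, inserted.
  let u : (Fin n → X) × X × X → ℝ := fun q => L (ins q.2.1 q.1) q.2.2
  let v : (Fin n → X) × X × X → ℝ := fun q => L (ins q.2.2 q.1) q.2.2
  have hu : Measurable u := hL.comp
    ((hins.comp (measurable_snd.fst.prodMk measurable_fst)).prodMk measurable_snd.snd)
  have hv : Measurable v := hL.comp
    ((hins.comp (measurable_snd.snd.prodMk measurable_fst)).prodMk measurable_snd.snd)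
  have hE : Measurable fun q : X × (Fin n → X) => ∫ z, L (ins q.1 q.2) z ∂μ :=
    (StronglyMeasurable.integral_prod_right' (f := fun p : (X × (Fin n → X)) × X =>
      L (ins p.1.1 p.1.2) p.2) (hL.comp ((hins.comp measurable_fst).prodMk
        measurable_snd)).stronglyMeasurable).measurable
  have hT : Measurable fun q : X × (Fin n → X) => L (ins q.1 q.2) q.1 :=
    hL.comp (hins.prodMk measurable_fst)
  have i1 : Integrable (fun q : X × (Fin n → X) => ∫ z, L (ins q.1 q.2) z ∂μ) (μ.prod ν) :=
    integrable_of_measurable_of_abs_le hE fun q => abs_integral_le_of_abs_le fun z => hM _ _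
  have i2 : Integrable (fun q : X × (Fin n → X) => L (ins q.1 q.2) q.1) (μ.prod ν) :=
    integrable_of_measurable_of_abs_le hT fun q => hM _ _
  have iu : Integrable u (ν.prod (μ.prod μ)) :=
    integrable_of_measurable_of_abs_le hu fun q => hM _ _
  have iv : Integrable v (ν.prod (μ.prod μ)) :=
    integrable_of_measurable_of_abs_le hv fun q => hM _ _
  have eu : ∫ q : X × (Fin n → X), (∫ z, L (ins q.1 q.2) z ∂μ) ∂(μ.prod ν) =
      ∫ q, u q ∂(ν.prod (μ.prod μ)) := by
    rw [integral_prod_symm _ i1, integral_prod _ iu]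
    refine integral_congr_ae (Filter.Eventually.of_forall fun r => ?_)
    exact (integral_prod (fun p : X × X => u (r, p)) (integrable_of_measurable_of_abs_le
      (hu.comp measurable_prodMk_left) fun q => hM _ _)).symm
  have ev : ∫ q : X × (Fin n → X), L (ins q.1 q.2) q.1 ∂(μ.prod ν) =
      ∫ q, v q ∂(ν.prod (μ.prod μ)) := by
    rw [integral_prod_symm _ i2, integral_prod _ iv]
    refine integral_congr_ae (Filter.Eventually.of_forall fun r => ?_)
    refine Eq.trans ?_ (integral_prod (fun p : X × X => v (r, p))
      (integrable_of_measurable_of_abs_le (hv.comp measurable_prodMk_left) fun q => hM _ _)).symm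
    simp [v]
  have e : ∫ S, (∫ z, L S z ∂μ - L S (S i)) ∂(Measure.pi fun _ => μ) =
      ∫ q, (u q - v q) ∂(ν.prod (μ.prod μ)) := by
    rw [integral_pi_eq_integral_insertNth μ i, integral_sub iu iv, ← eu, ← ev, ← integral_sub i1 i2]
    simp [ins, ν]
  rw [e]
  refine (integral_mono (iu.sub iv) (integrable_const β) fun q =>
    hβ _ _ (insertNth_congr i q.2.1 q.2.2 q.1) q.2.2).trans ?_
  simp

/-- **Generalization from uniform stability**. If replacing one training example changes the loss of
a learning algorithm by at most `β` everywhere, its generalization error has mean at most `β` and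
changes by at most `2 β + M / n`, so McDiarmid's inequality applies. -/
lemma generalization_of_uniform_stability {n : ℕ} (hn : 1 ≤ n) {L : (Fin n → X) → X → ℝ}
    (hL : Measurable (Function.uncurry L)) {M β : ℝ}
    (hM : ∀ S z, 0 ≤ L S z ∧ L S z ≤ M) (hβ0 : 0 < β)
    (hβ : ∀ i S S', (∀ k, k ≠ i → S k = S' k) → ∀ z, L S z - L S' z ≤ β) {δ : ℝ} (hδ0 : 0 < δ)
    (hδ1 : δ < 1) :
    1 - δ ≤ (Measure.pi fun _ : Fin n => μ).real
      {S | ∫ z, L S z ∂μ - (∑ i, L S (S i)) / n ≤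
        β + (2 * n * β + M) * Real.sqrt (Real.log (1 / δ) / (2 * n))} := by
  obtain ⟨x₀⟩ : Nonempty X := nonempty_of_isProbabilityMeasure μ
  have hM0 : 0 ≤ M := (hM (fun _ => x₀) x₀).1.trans (hM (fun _ => x₀) x₀).2
  have hn0 : (0 : ℝ) < n := by exact_mod_cast hn
  have hMabs (S z) : |L S z| ≤ M := by
    rw [abs_of_nonneg (hM S z).1]; exact (hM S z).2
  set P : Measure (Fin n → X) := Measure.pi fun _ => μ
  have hdiag (i : Fin n) : Measurable fun S => L S (S i) :=
    hL.comp (measurable_id.prodMk (measurable_pi_apply i))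
  have hE : Measurable fun S => ∫ z, L S z ∂μ :=
    (StronglyMeasurable.integral_prod_right' hL.stronglyMeasurable).measurable
  have hLS (S) : Integrable (L S) μ :=
    integrable_of_measurable_of_abs_le (hL.comp measurable_prodMk_left) (hMabs S)
  let F : (Fin n → X) → ℝ := fun S => ∫ z, L S z ∂μ - (∑ i, L S (S i)) / n
  have hF : Measurable F :=
    hE.sub ((Finset.measurable_sum _ fun i _ => hdiag i).div_const _)
  have hFB (S) : |F S| ≤ M := by
    have a1 : 0 ≤ ∫ z, L S z ∂μ := integral_nonneg fun z => (hM S z).1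
    have a2 : ∫ z, L S z ∂μ ≤ M := (le_abs_self _).trans (abs_integral_le_of_abs_le (hMabs S))
    have a3 : 0 ≤ (∑ i, L S (S i)) / n :=
      div_nonneg (Finset.sum_nonneg fun i _ => (hM S _).1) hn0.le
    have a4 : (∑ i, L S (S i)) / n ≤ M := by
      rw [div_le_iff₀ hn0]
      refine (Finset.sum_le_sum fun i _ => (hM S (S i)).2).trans (le_of_eq ?_)
      simp [mul_comm]
    rw [abs_le]
    constructor <;> simp only [F] <;> linarith
  have mean : ∫ S, F S ∂P ≤ β := by
    have e (S) : F S = (∑ i, (∫ z, L S z ∂μ - L S (S i))) / n := by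
      simp only [F]
      rw [Finset.sum_sub_distrib, sub_div, Finset.sum_const, Finset.card_univ, Fintype.card_fin,
        nsmul_eq_mul, mul_div_cancel_left₀ _ hn0.ne']
    have hterm (i : Fin n) : Integrable (fun S => ∫ z, L S z ∂μ - L S (S i)) P :=
      (integrable_of_measurable_of_abs_le hE fun S => abs_integral_le_of_abs_le (hMabs S)).sub
        (integrable_of_measurable_of_abs_le (hdiag i) fun S => hMabs _ _)
    simp only [e]
    rw [integral_div, integral_finsetSum _ fun i _ => hterm i, div_le_iff₀ hn0]
    refine (Finset.sum_le_sum fun i _ =>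
      integral_sub_apply_le_of_stable μ hL hMabs i (hβ i)).trans (le_of_eq ?_)
    simp [mul_comm]
  have diff (i : Fin n) (S S' : Fin n → X) (h : ∀ k, k ≠ i → S k = S' k) :
      F S - F S' ≤ (2 * n * β + M) / n := by
    have h1 : ∫ z, L S z ∂μ - ∫ z, L S' z ∂μ ≤ β := by
      rw [← integral_sub (hLS S) (hLS S')]
      refine (integral_mono ((hLS S).sub (hLS S')) (integrable_const β) (hβ i S S' h)).trans ?_
      simp
    have h2 : ∑ k, L S' (S' k) - ∑ k, L S (S k) ≤ n * β + M := by
      rw [← Finset.sum_sub_distrib]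
      refine (Finset.sum_le_sum (g := fun k => β + if k = i then M else 0) fun k _ => ?_).trans ?_
      · split_ifs with hk
        · linarith [(hM S' (S' k)).2, (hM S (S k)).1]
        · rw [h k hk, add_zero]
          exact hβ i S' S (fun j hj => (h j hj).symm) _
      · simp [Finset.sum_add_distrib]
    have h3 : (∑ k, L S' (S' k)) / n - (∑ k, L S (S k)) / n ≤ (n * β + M) / n := by
      rw [← sub_div]; gcongr
    have h4 : (2 * n * β + M) / n = β + (n * β + M) / n := by field_simp; ring
    simp only [F]
    linarith
  have hlog : 0 < Real.log (1 / δ) := Real.log_pos (by rw [one_lt_div hδ0]; exact hδ1)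
  have hA : 0 < 2 * n * β + M := by positivity
  set s := (2 * n * β + M) * Real.sqrt (Real.log (1 / δ) / (2 * n)) with hs
  have tail := measureReal_boundedDifferences_le μ F hF hFB (fun _ => (2 * n * β + M) / n) diff
    (s := s) (by positivity)
  have exponent : Real.exp (-s ^ 2 / (2 * ∑ _i : Fin n, ((2 * n * β + M) / n / 2) ^ 2)) = δ := by
    have : -s ^ 2 / (2 * ∑ _i : Fin n, ((2 * n * β + M) / n / 2) ^ 2) = Real.log δ := by
      rw [hs, mul_pow, Real.sq_sqrt (by positivity), Finset.sum_const, Finset.card_univ,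
        Fintype.card_fin, nsmul_eq_mul, one_div, Real.log_inv]
      field_simp
    rw [this, Real.exp_log hδ0]
  rw [exponent] at tail
  have meas : MeasurableSet {S | F S ≤ β + s} := measurableSet_le hF measurable_const
  have compl : P.real {S | F S ≤ β + s}ᶜ ≤ δ := by
    refine (measureReal_mono fun S hS => ?_).trans tail
    simp only [Set.mem_compl_iff, Set.mem_ofPred_eq, not_le] at hS ⊢
    linarith
  rw [probReal_compl_eq_one_sub meas] at compl
  change 1 - δ ≤ P.real {S | F S ≤ β + s}
  linarith

end Generalization

/-! ### SGD as an algorithm averaged over its indices -/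

section Sgd

variable {a b p K : ℕ}

instance : Countable (Sample a b K) :=
  Function.Injective.countable (f := fun z : Sample a b K => (z.query, z.doc, z.label))
    fun z z' h => by
      cases z
      cases z'
      simpa using h

instance : DiscreteMeasurableSpace (Sample a b K) := ⟨fun _ => trivial⟩

lemma sampleLoss_mem {κ M ε : ℝ} (hε : 0 < ε) {l : ℝ → Fin K → ℝ}
    (hl : IsSmoothBoundedLoss κ M l) (z : Sample a b K) (w : Params a b p) :
    0 ≤ sampleLoss l ε z w ∧ sampleLoss l ε z w ≤ M :=
  (hl z.label).2 _ (relevance_mem_Ioo hε w _ _)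

/-- Averaging over the indices turns SGD into a deterministic algorithm, whose loss at `z` is the
average loss of the random outputs. -/
lemma sgdGeneralizationError_eq {κ M ε : ℝ} (hε : 0 < ε) {l : ℝ → Fin K → ℝ}
    (hl : IsSmoothBoundedLoss κ M l) (c : ℝ) (w₀ : Params a b p) (T : ℕ)
    (E : Measure (Sample a b K)) [IsProbabilityMeasure E] {n : ℕ} (S : Fin n → Sample a b K) :
    sgdGeneralizationError l ε c w₀ T E S =
      ∫ z, (Finset.expect Finset.univ fun ι : Fin T → Fin n =>
        sampleLoss l ε z (sgd l ε c w₀ S ι)) ∂E -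
      (∑ i, Finset.expect Finset.univ fun ι : Fin T → Fin n =>
        sampleLoss l ε (S i) (sgd l ε c w₀ S ι)) / n := by
  rw [sgdGeneralizationError, Finset.expect_sub_distrib]
  congr 1
  · simp only [Fintype.expect_eq_sum_div_card, expectedError]
    rw [integral_div, integral_finsetSum]
    refine fun ι _ => integrable_of_measurable_of_abs_le Measurable.of_discrete (B := M) fun z => ?_
    have := sampleLoss_mem hε hl z (sgd l ε c w₀ S ι)
    rw [abs_of_nonneg this.1]
    exact this.2
  · simp only [trainingError]
    rw [← Finset.expect_div, Finset.expect_sum_comm]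

end Sgd

end SmoothSearch

end

theorem mainTheorem1 :
    -- SOSL is an admissible loss
    (∀ (K : ℕ) (θ : Fin (K + 1) → ℝ), StrictMono θ → θ 0 = -1 → θ (Fin.last K) = 1 →
      SmoothSearch.IsSmoothBoundedLoss 2 4 (SmoothSearch.sosl θ)) ∧
    -- the bound, for every smooth bounded loss
    ∀ (M c : ℝ), 0 < c → ∃ C : ℝ≥0 → ℝ → ℝ, ∀ (ε κ : ℝ), 0 < ε →
      ∃ (α₀ : ℝ≥0) (γ₀ : ℝ), 0 < γ₀ ∧
        ∀ (a b p K : ℕ) (l : ℝ → Fin K → ℝ), SmoothSearch.IsSmoothBoundedLoss κ M l →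
          -- the loss is Lipschitz and smooth in the model parameters
          (∀ z : SmoothSearch.Sample a b K,
            LipschitzWith α₀ (SmoothSearch.sampleLoss (p := p) l ε z) ∧
              SmoothSearch.SmoothOnWith γ₀ (SmoothSearch.sampleLoss (p := p) l ε z) Set.univ) ∧
          -- with any such constants, the generalization error bound holds
          ∀ (α : ℝ≥0) (γ : ℝ), 0 < γ →
            (∀ z : SmoothSearch.Sample a b K,
              LipschitzWith α (SmoothSearch.sampleLoss (p := p) l ε z) ∧
                SmoothSearch.SmoothOnWith γ (SmoothSearch.sampleLoss (p := p) l ε z) Set.univ) →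
            ∀ T : ℕ, 1 ≤ T →
              ∃ β : ℕ → ℝ,
                (∀ n : ℕ, 1 ≤ n →
                  0 ≤ β n ∧ β n ≤ C α γ * ((T : ℝ) ^ (1 - 1 / (γ * c + 1)) / n)) ∧
                ∀ (w₀ : SmoothSearch.Params a b p) (E : Measure (SmoothSearch.Sample a b K))
                  [IsProbabilityMeasure E] (n : ℕ) (δ : ℝ), 1 ≤ n → 0 < δ → δ < 1 →
                  1 - δ ≤ (Measure.pi fun _ : Fin n => E).real
                    {S | SmoothSearch.sgdGeneralizationError l ε c w₀ T E S ≤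
                      2 * β n + (4 * n * β n + M) * Real.sqrt (Real.log (1 / δ) / (2 * n))} := by
  refine ⟨fun K θ hθ h0 h1 => SmoothSearch.isSmoothBoundedLoss_sosl hθ h0 h1, fun M c hc =>
    ⟨SmoothSearch.stabilityConst M, fun ε κ hε => ?_⟩⟩
  set α₀ : ℝ≥0 := ⟨(|M| + 2 * |κ|) * (4 / ε), by positivity⟩
  set γ₁ : ℝ := |κ| * (4 / ε) ^ 2 + (|M| + 2 * |κ|) * (20 / ε ^ 2 + 8 / ε)
  have hγ₁0 : 0 ≤ γ₁ := by positivity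
  refine ⟨α₀, γ₁ + 1, by positivity, fun a b p K l hl => ⟨fun z => ?_, ?_⟩⟩
  · have h : SmoothSearch.C11On α₀ γ₁ (SmoothSearch.sampleLoss (p := p) l ε z) Set.univ :=
      SmoothSearch.c11On_sampleLoss hε hl z
    refine ⟨h.lipschitzWith, h.smoothOnWith.1, fun u hu v hv => ?_⟩
    refine (h.smoothOnWith.2 u hu v hv).trans ?_
    gcongr
    linarith
  intro α γ hγ hloss T hT
  have hT0 : (0 : ℝ) < T := by exact_mod_cast hT
  have hC : 0 < SmoothSearch.stabilityConst M α γ := by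
    rw [SmoothSearch.stabilityConst]; positivity
  refine ⟨fun n => SmoothSearch.stabilityConst M α γ * ((T : ℝ) ^ (1 - 1 / (γ * c + 1)) / n),
    fun n _ => ⟨by positivity, le_rfl⟩, fun w₀ E _ n δ hn hδ0 hδ1 => ?_⟩
  set β := SmoothSearch.stabilityConst M α γ * ((T : ℝ) ^ (1 - 1 / (γ * c + 1)) / n)
  have hn0 : (0 : ℝ) < n := by exact_mod_cast hn
  have hβ0 : 0 < β := by positivity
  have hM := SmoothSearch.sampleLoss_mem (a := a) (b := b) (p := p) hε hl
  have : Nonempty (Fin n) := ⟨⟨0, hn⟩⟩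
  have key := SmoothSearch.generalization_of_uniform_stability E hn (M := M) (β := β)
    (L := fun S z => Finset.expect Finset.univ fun ι : Fin T → Fin n =>
      SmoothSearch.sampleLoss l ε z (SmoothSearch.sgd l ε c w₀ S ι)) Measurable.of_discrete
    (fun S z => ⟨Finset.expect_nonneg fun ι _ => (hM z _).1,
      Finset.expect_le Finset.univ_nonempty fun ι _ => (hM z _).2⟩) hβ0
    (fun i S S' hS z => by
      rw [← Finset.expect_sub_distrib]
      exact (Finset.expect_le_expect fun ι _ => le_abs_self _).trans
        (SmoothSearch.uniform_stability_sgd hc hγ hM hloss w₀ hT S S' i hS z)) hδ0 hδ1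
  refine key.trans (measureReal_mono fun S hS => ?_)
  rw [Set.mem_ofPred_eq] at hS ⊢
  rw [SmoothSearch.sgdGeneralizationError_eq hε hl]
  -- Stability under replacement gives half of the stated multiples of `β`.
  refine hS.trans ?_
  have : 0 ≤ 2 * n * β := by positivity
  gcongr <;> linarith
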